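/- Let $\mathbb B$ be the biharmonic algebra, i.e. the commutative associative algebra over $\mathbb C$ with basis $e_1=1,\ e_2$ and $e_2^2=e_1+2ie_2$, with the Euclidean norm $\|z_1e_1+z_2e_2\|=\sqrt{|z_1|^2+|z_2|^2}$. Let $\mu=\{\zeta=xe_1+ye_2: x,y\in\mathbb R\}$ be the biharmonic plane (every nonzero element of $\mu$ is invertible in $\mathbb B$), let $D_\zeta=\{\zeta\in\mu:\|\zeta\|<1\}$, with boundary circle $\partial D_\zeta$ (oriented counterclockwise) and closure $\overline{D_\zeta}$ in $\mu$. A function $\Phi$ is monogenic in $D_\zeta$ if the limit of $(\Phi(\zeta+h)-\Phi(\zeta))h^{-1}$ as $h\to0$, $h\in\mu\setminus\{0\}$, exists at every $\zeta\in D_\zeta$. A function $f$ on $\partial D_\zeta$ with values in $\mathbb R$ or $\mathbb B$ satisfies the Dini condition if $\int_0^1\omega(f,\eta)\,\eta^{-1}d\eta<\infty$, where $\omega(f,\varepsilon)=\sup\{\|f(\tau_1)-f(\tau_2)\| : \tau_1,\tau_2\in\partial D_\zeta,\ \|\tau_1-\tau_2\|\le\varepsilon\}$. For such $f$ put $$S_{D_\zeta}[f](\zeta)=\frac1{2\pi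 i}\int_{\partial D_\zeta} f(\tau)(\tau+\zeta)(\tau-\zeta)^{-1}\tau^{-1}\,d\tau,\qquad \zeta\in D_\zeta,$$ and let $\mathcal M$ be the class of functions that coincide in $D_\zeta$ with $S_{D_\zeta}[\varphi]$ for some $\varphi:\partial D_\zeta\to\mathbb B$ satisfying the Dini condition. Let $u_1,u_3:\partial D_\zeta\to\mathbb R$ satisfy the Dini condition. The (1-3)-problem is to find a continuous function $\Phi=U_1e_1+U_2ie_1+U_3e_2+U_4ie_2:\overline{D_\zeta}\to\mathbb B$ (with real $U_k$), monogenic in $D_\zeta$, such that $U_1=u_1$ and $U_3=u_3$ on $\partial D_\zeta$. This problem is solvable in the class $\mathcal M$ if and only if $$\int_{\partial D_\zeta}u_1(\zeta)\,dx+u_3(\zeta)\,dy=0.$$ If this condition holds, the general solution in $\mathcal M$ is given by $$\Phi(\zeta)=S_{D_\zeta}[u_1](\zeta)e_1+S_{D_\zeta}[u_3](\zeta)e_2+b\zeta+b_1e_1+b_2e_2+i(a\zeta+a_1e_1+a_2e_2),\qquad \zeta\in D_\zeta,$$ where $a,a_1,a_2$ are arbitrary real constants: every solution in $\mathcal M$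 has this form for some $a,a_1,a_2$, and for all real $a,a_1,a_2$ there is a solution in $\mathcal M$ that is given in $D_\zeta$ by this formula. Here $$b=-\frac1{2\pi}\operatorname{Re}\int_{\partial D}\frac{\widehat u_3(t)}{t^2}dt-\frac1{2\pi}\operatorname{Im}\int_{\partial D}\frac{\widehat u_1(t)}{t^2}dt,$$ $$b_1=-\frac1{2\pi}\operatorname{Re}\int_{\partial D}\frac{\widehat u_3(t)}{t^3}dt-\frac1{2\pi}\operatorname{Im}\int_{\partial D}\frac{\widehat u_1(t)}{t^3}dt,$$ $$b_2=\frac1{2\pi}\operatorname{Im}\int_{\partial D}\frac{\widehat u_3(t)}{t^3}dt-\frac1{2\pi}\operatorname{Re}\int_{\partial D}\frac{\widehat u_1(t)}{t^3}dt,$$ with $\partial D$ the unit circle of the complex plane (counterclockwise) and $\widehat u_k(x+iy)=u_k(xe_1+ye_2)$. -/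

import Mathlib

open scoped Real Topology

noncomputable section

/-- The biharmonic algebra: the commutative algebra over `ℂ` with basis `e₁ = 1`, `e₂` and
`e₂ ^ 2 = e₁ + 2 i e₂`. For `a = z₁ e₁ + z₂ e₂` we have `a.re = z₁` and `a.im = z₂`, which are
complex numbers. -/
abbrev BiharmonicAlgebra : Type := QuadraticAlgebra ℂ 1 (2 * Complex.I)

namespace BiharmonicAlgebra

/-- The basis element `e₁`. -/
def e₁ : BiharmonicAlgebra := ⟨1, 0⟩

/-- The basis element `e₂`. -/
def e₂ : BiharmonicAlgebra := ⟨0, 1⟩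

theorem e₁_eq_one : e₁ = 1 := rfl

theorem e₂_mul_self : e₂ * e₂ = e₁ + (2 * Complex.I) • e₂ := by
  ext <;> simp [e₁, e₂]

/-- The coordinates `(z₁, z₂)`, as a point of the Euclidean space `ℂ ^ 2`. -/
def toEuclidean : BiharmonicAlgebra →ₗ[ℝ] WithLp 2 (ℂ × ℂ) where
  toFun a := WithLp.toLp 2 (a.re, a.im)
  map_add' _ _ := rfl
  map_smul' _ _ := rfl

theorem toEuclidean_injective : Function.Injective toEuclidean := by
  intro a b h
  have h' : (a.re, a.im) = (b.re, b.im) := congrArg WithLp.ofLp h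
  exact QuadraticAlgebra.ext (Prod.ext_iff.1 h').1 (Prod.ext_iff.1 h').2

/-- The Euclidean norm on the biharmonic algebra. -/
instance instNormedAddCommGroup : NormedAddCommGroup BiharmonicAlgebra :=
  NormedAddCommGroup.induced BiharmonicAlgebra (WithLp 2 (ℂ × ℂ)) toEuclidean
    toEuclidean_injective

instance instNormedSpace : NormedSpace ℝ BiharmonicAlgebra :=
  NormedSpace.induced ℝ BiharmonicAlgebra (WithLp 2 (ℂ × ℂ)) toEuclidean

theorem norm_eq (a : BiharmonicAlgebra) : ‖a‖ = √(‖a.re‖ ^ 2 + ‖a.im‖ ^ 2) := by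
  change ‖WithLp.toLp 2 (a.re, a.im)‖ = _
  rw [WithLp.prod_norm_eq_of_L2]
  rfl

instance instFiniteDimensional : FiniteDimensional ℝ BiharmonicAlgebra :=
  Module.Finite.of_injective toEuclidean toEuclidean_injective

instance instCompleteSpace : CompleteSpace BiharmonicAlgebra :=
  FiniteDimensional.complete ℝ BiharmonicAlgebra

/-- The point `x e₁ + y e₂` with real coordinates. -/
def point (x y : ℝ) : BiharmonicAlgebra := x • e₁ + y • e₂

/-- The biharmonic plane `μ`. -/
def plane : Set BiharmonicAlgebra := {ζ | ∃ x y : ℝ, ζ = point x y}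

/-- The open unit disk of the biharmonic plane. -/
def openDisk : Set BiharmonicAlgebra := {ζ | ζ ∈ plane ∧ ‖ζ‖ < 1}

/-- The closed unit disk of the biharmonic plane. -/
def closedDisk : Set BiharmonicAlgebra := {ζ | ζ ∈ plane ∧ ‖ζ‖ ≤ 1}

/-- The unit circle of the biharmonic plane. -/
def unitCircle : Set BiharmonicAlgebra := {ζ | ζ ∈ plane ∧ ‖ζ‖ = 1}

/-- The biharmonic plane has no zero divisors except `0`, so that division by its nonzero elements
(written with `Ring.inverse`) is genuine division. -/
theorem isUnit_of_mem_plane {ζ : BiharmonicAlgebra} (hζ : ζ ∈ plane) (h0 : ζ ≠ 0) :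
    IsUnit ζ := by
  obtain ⟨x, y, rfl⟩ := hζ
  have hz : (x : ℂ) + y * Complex.I ≠ 0 := by
    intro h
    apply h0
    have hx : x = 0 := by simpa using congrArg Complex.re h
    have hy : y = 0 := by simpa using congrArg Complex.im h
    simp [point, hx, hy]
  refine IsUnit.of_mul_eq_one
    (⟨((x : ℂ) + 2 * Complex.I * y) / (x + y * Complex.I) ^ 2,
      -(y : ℂ) / (x + y * Complex.I) ^ 2⟩ : BiharmonicAlgebra) ?_
  have hI : Complex.I ^ 2 = -1 := Complex.I_sq
  ext
  · simp only [point, e₁, e₂, QuadraticAlgebra.re_mul, QuadraticAlgebra.re_add,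
      QuadraticAlgebra.im_add, QuadraticAlgebra.re_smul, QuadraticAlgebra.im_smul,
      QuadraticAlgebra.re_one, Complex.real_smul]
    field_simp
    linear_combination (-(y : ℂ) ^ 2) * hI
  · simp only [point, e₁, e₂, QuadraticAlgebra.im_mul, QuadraticAlgebra.re_add,
      QuadraticAlgebra.im_add, QuadraticAlgebra.re_smul, QuadraticAlgebra.im_smul,
      QuadraticAlgebra.im_one, Complex.real_smul]
    field_simp
    ring

/-- `Φ` has the derivative `d` at `ζ` along the biharmonic plane. -/
def HasDerivAlongPlane (Φ : BiharmonicAlgebra → BiharmonicAlgebra) (d ζ : BiharmonicAlgebra) :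
    Prop :=
  Filter.Tendsto (fun h => (Φ (ζ + h) - Φ ζ) * Ring.inverse h) (𝓝[plane \ {0}] 0) (𝓝 d)

/-- `Φ` is monogenic in `U` (a subset of the biharmonic plane that is open in it). -/
def IsMonogenicOn (Φ : BiharmonicAlgebra → BiharmonicAlgebra) (U : Set BiharmonicAlgebra) : Prop :=
  ∀ ζ ∈ U, ∃ d, HasDerivAlongPlane Φ d ζ

/-- The modulus of continuity of a function on the unit circle of the biharmonic plane, with
values in `[0, ∞]`. -/
def modulusOfContinuity {E : Type} [PseudoEMetricSpace E] (f : BiharmonicAlgebra → E) (ε : ℝ) :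
    ENNReal :=
  ⨆ τ₁ ∈ unitCircle, ⨆ τ₂ ∈ unitCircle, ⨆ _ : ‖τ₁ - τ₂‖ ≤ ε, edist (f τ₁) (f τ₂)

/-- The Dini condition `∫₀¹ ω(f, η) / η dη < ∞` on the unit circle. -/
def IsDini {E : Type} [PseudoEMetricSpace E] (f : BiharmonicAlgebra → E) : Prop :=
  ∫⁻ η in Set.Ioc (0 : ℝ) 1, modulusOfContinuity f η / ENNReal.ofReal η < ⊤

/-- `∫ f(τ) dτ` over the unit circle of the biharmonic plane (counterclockwise), through
`τ = cos θ e₁ + sin θ e₂` and `dτ = (- sin θ e₁ + cos θ e₂) dθ`. -/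
def planeCircleIntegral (f : BiharmonicAlgebra → BiharmonicAlgebra) : BiharmonicAlgebra :=
  ∫ θ in (0 : ℝ)..(2 * π),
    f (point (Real.cos θ) (Real.sin θ)) * point (-Real.sin θ) (Real.cos θ)

/-- `∫ u dx + v dy` over the unit circle of the biharmonic plane (counterclockwise). -/
def lineIntegral (u v : BiharmonicAlgebra → ℝ) : ℝ :=
  ∫ θ in (0 : ℝ)..(2 * π),
    (u (point (Real.cos θ) (Real.sin θ)) * (-Real.sin θ) +
      v (point (Real.cos θ) (Real.sin θ)) * Real.cos θ)

/-- The Schwartz-type integral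
`(2 π i)⁻¹ ∫ φ(τ) (τ + ζ) (τ - ζ)⁻¹ τ⁻¹ dτ` with a density `φ` with values in the algebra. -/
def schwartzIntegral (φ : BiharmonicAlgebra → BiharmonicAlgebra) (ζ : BiharmonicAlgebra) :
    BiharmonicAlgebra :=
  (1 / (2 * π * Complex.I) : ℂ) •
    planeCircleIntegral (fun τ => φ τ * (τ + ζ) * Ring.inverse (τ - ζ) * Ring.inverse τ)

/-- The Schwartz-type integral of a real-valued density. -/
def schwartzIntegralReal (u : BiharmonicAlgebra → ℝ) (ζ : BiharmonicAlgebra) :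
    BiharmonicAlgebra :=
  schwartzIntegral (fun τ => u τ • e₁) ζ

/-- The class of functions that are represented in the open unit disk by the Schwartz-type integral
of a density that satisfies the Dini condition. -/
def SchwartzClass : Set (BiharmonicAlgebra → BiharmonicAlgebra) :=
  {Φ | ∃ φ : BiharmonicAlgebra → BiharmonicAlgebra, IsDini φ ∧
    ∀ ζ ∈ openDisk, Φ ζ = schwartzIntegral φ ζ}

/-- `Φ` solves the (1-3)-problem for the unit disk: it is continuous on the closed disk, monogenic
in the open disk, and in `Φ = U₁ e₁ + U₂ i e₁ + U₃ e₂ + U₄ i e₂` the components `U₁` and `U₃` have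
the prescribed values on the circle. -/
structure SolvesProblem13 (u₁ u₃ : BiharmonicAlgebra → ℝ)
    (Φ : BiharmonicAlgebra → BiharmonicAlgebra) : Prop where
  continuousOn : ContinuousOn Φ closedDisk
  monogenic : IsMonogenicOn Φ openDisk
  boundary₁ : ∀ ζ ∈ unitCircle, (Φ ζ).re.re = u₁ ζ
  boundary₃ : ∀ ζ ∈ unitCircle, (Φ ζ).im.re = u₃ ζ

/-- The integral of `û(t) / t ^ k` over the unit circle of the complex plane, where
`û(x + i y) = u(x e₁ + y e₂)`. -/
def moment (u : BiharmonicAlgebra → ℝ) (k : ℕ) : ℂ :=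
  ∮ t in C(0, 1), (u (point t.re t.im) : ℂ) / t ^ k

def coeffB (u₁ u₃ : BiharmonicAlgebra → ℝ) : ℝ :=
  -(1 / (2 * π)) * (moment u₃ 2).re - (1 / (2 * π)) * (moment u₁ 2).im

def coeffB₁ (u₁ u₃ : BiharmonicAlgebra → ℝ) : ℝ :=
  -(1 / (2 * π)) * (moment u₃ 3).re - (1 / (2 * π)) * (moment u₁ 3).im

def coeffB₂ (u₁ u₃ : BiharmonicAlgebra → ℝ) : ℝ :=
  (1 / (2 * π)) * (moment u₃ 3).im - (1 / (2 * π)) * (moment u₁ 3).re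

/-- The expression
`S[u₁](ζ) e₁ + S[u₃](ζ) e₂ + b ζ + b₁ e₁ + b₂ e₂ + i (a ζ + a₁ e₁ + a₂ e₂)`. -/
def generalSolution (u₁ u₃ : BiharmonicAlgebra → ℝ) (a a₁ a₂ : ℝ) (ζ : BiharmonicAlgebra) :
    BiharmonicAlgebra :=
  schwartzIntegralReal u₁ ζ * e₁ + schwartzIntegralReal u₃ ζ * e₂ +
    coeffB u₁ u₃ • ζ + coeffB₁ u₁ u₃ • e₁ + coeffB₂ u₁ u₃ • e₂ +
    Complex.I • (a • ζ + a₁ • e₁ + a₂ • e₂)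

end BiharmonicAlgebra

end

noncomputable section

namespace BiharmonicAlgebra

open Complex Filter Metric Set MeasureTheory ComplexConjugate

/-! The element `ρ = e₂ - i` satisfies `ρ² = 0`, so the algebra is the ring of dual numbers over
`ℂ`, and the point `x e₁ + y e₂` is `z + y ρ` with `z = x + iy`. Write `Φ = A + B ρ`. Then `Φ` is
monogenic iff `A` and `B - y A'` are holomorphic in `z`, and `U₁ = Re A + Im B`, `U₃ = Re B`
(`isMonogenicOn_openDisk_iff`).

The term `y A'` may blow up at the circle, but `y = (z - 1/z)/(2i) + (1 - |z|²)/(2iz)`, and `(1 -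
|z|²) A'` tends to `0` whenever `A` is continuous up to the circle, by a Cauchy estimate. Hence `y`
may be traded for a rational function of `z` without changing boundary values.

Existence: for a Dini density `u`, the `A`-part of `S[u]` is the classical Schwarz integral, which
extends continuously with real part `u` on the circle. By the trade above, its `B`-part has the
boundary values `(m₂ z̄ + m₃)/(2π)`, where `mₖ` are the moments of `u`
(`IsDini.exists_continuous_extension`). So `S[u₁] e₁ + S[u₃] e₂` misses the data only by an affine
function of `x, y`. The constants `b, b₁, b₂` remove all of it except `l y` in `U₁` and `-l x` in
`U₃`, where `2πl` is the line integral of the solvability condition.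

Uniqueness and necessity: subtracting this function from any solution leaves a monogenic function
with `U₁ = -l y`, `U₃ = l x` on the circle. Two applications of the fact that a holomorphic function
with zero real part on the circle is an imaginary constant determine it explicitly and force `l = 0`
(`boundary_uniqueness`). -/

/-- The algebra homomorphism onto `ℂ` whose kernel is spanned by the nilpotent element
`ρ = e₂ - i`: in `a = z + w ρ` with complex `z` and `w`, the coefficient `z`. -/
def hol (a : BiharmonicAlgebra) : ℂ := a.re + I * a.im

/-- In `a = z + w ρ` with complex `z` and `w`, the coefficient `w`. -/
def nil (a : BiharmonicAlgebra) : ℂ := a.im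

/-! ### Dual-number coordinates -/

theorem ext_hol_nil {a b : BiharmonicAlgebra} (h : hol a = hol b) (h' : nil a = nil b) :
    a = b := by
  simp only [hol, nil] at h h'
  rw [h'] at h
  exact QuadraticAlgebra.ext (add_right_cancel h) h'

theorem re_eq (a : BiharmonicAlgebra) : a.re = hol a - I * nil a := by simp [hol, nil]

theorem im_eq (a : BiharmonicAlgebra) : a.im = nil a := rfl

@[simp] theorem hol_add (a b : BiharmonicAlgebra) : hol (a + b) = hol a + hol b := by
  simp [hol]; ring
@[simp] theorem nil_add (a b : BiharmonicAlgebra) : nil (a + b) = nil a + nil b := rfl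
@[simp] theorem hol_sub (a b : BiharmonicAlgebra) : hol (a - b) = hol a - hol b := by
  simp [hol]; ring
@[simp] theorem nil_sub (a b : BiharmonicAlgebra) : nil (a - b) = nil a - nil b := rfl
@[simp] theorem hol_mul (a b : BiharmonicAlgebra) : hol (a * b) = hol a * hol b := by
  simp only [hol, QuadraticAlgebra.re_mul, QuadraticAlgebra.im_mul]
  linear_combination (a.im * b.im) * I_sq
@[simp] theorem nil_mul (a b : BiharmonicAlgebra) :
    nil (a * b) = hol a * nil b + nil a * hol b := by
  simp only [hol, nil, QuadraticAlgebra.im_mul]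
  ring
@[simp] theorem hol_smul (c : ℂ) (a : BiharmonicAlgebra) : hol (c • a) = c * hol a := by
  simp [hol]; ring
@[simp] theorem nil_smul (c : ℂ) (a : BiharmonicAlgebra) : nil (c • a) = c * nil a := rfl
@[simp] theorem hol_real_smul (c : ℝ) (a : BiharmonicAlgebra) : hol (c • a) = c * hol a := by
  simp [hol]; ring
@[simp] theorem nil_real_smul (c : ℝ) (a : BiharmonicAlgebra) : nil (c • a) = c * nil a := rfl
@[simp] theorem hol_zero : hol 0 = 0 := by simp [hol]
@[simp] theorem nil_zero : nil 0 = 0 := rfl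
@[simp] theorem hol_one : hol 1 = 1 := by
  simp [hol, QuadraticAlgebra.re_one, QuadraticAlgebra.im_one]
@[simp] theorem nil_one : nil 1 = 0 := rfl
@[simp] theorem hol_e₁ : hol e₁ = 1 := hol_one
@[simp] theorem nil_e₁ : nil e₁ = 0 := rfl
@[simp] theorem hol_e₂ : hol e₂ = I := by simp [hol, e₂]
@[simp] theorem nil_e₂ : nil e₂ = 1 := rfl
@[simp] theorem hol_point (x y : ℝ) : hol (point x y) = x + y * I := by simp [point]
@[simp] theorem nil_point (x y : ℝ) : nil (point x y) = y := by simp [point]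

/-- The coordinates `(z, w)` of `a = z + w ρ`. -/
def dualEquiv : BiharmonicAlgebra ≃L[ℝ] ℂ × ℂ :=
  LinearEquiv.toContinuousLinearEquiv
    { toFun := fun a => (hol a, nil a)
      invFun := fun p => ⟨p.1 - I * p.2, p.2⟩
      map_add' := fun a b => by simp
      map_smul' := fun c a => by simp
      left_inv := fun a => by ext <;> simp [hol, nil]
      right_inv := fun p => by ext <;> simp [hol, nil] }

@[simp] theorem dualEquiv_apply (a : BiharmonicAlgebra) : dualEquiv a = (hol a, nil a) := rfl

theorem continuous_hol : Continuous hol := continuous_fst.comp dualEquiv.continuous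
theorem continuous_nil : Continuous nil := continuous_snd.comp dualEquiv.continuous

theorem tendsto_iff {α : Type*} {l : Filter α} {f : α → BiharmonicAlgebra}
    {a : BiharmonicAlgebra} : Tendsto f l (𝓝 a) ↔
      Tendsto (fun x => hol (f x)) l (𝓝 (hol a)) ∧ Tendsto (fun x => nil (f x)) l (𝓝 (nil a)) := by
  rw [dualEquiv.toHomeomorph.isInducing.tendsto_nhds_iff]
  exact Prod.tendsto_iff _ _

theorem continuous_iff {α : Type*} [TopologicalSpace α] {f : α → BiharmonicAlgebra} :
    Continuous f ↔ Continuous (fun x => hol (f x)) ∧ Continuous (fun x => nil (f x)) := by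
  simp only [continuous_iff_continuousAt, ContinuousAt, tendsto_iff, forall_and]

theorem continuousOn_iff {α : Type*} [TopologicalSpace α] {f : α → BiharmonicAlgebra}
    {s : Set α} : ContinuousOn f s ↔
      ContinuousOn (fun x => hol (f x)) s ∧ ContinuousOn (fun x => nil (f x)) s := by
  simp only [ContinuousOn, ContinuousWithinAt, tendsto_iff]
  exact forall₂_and

theorem hol_mul_inverse {a : BiharmonicAlgebra} (ha : IsUnit a) :
    hol a * hol (Ring.inverse a) = 1 := by
  rw [← hol_mul, Ring.mul_inverse_cancel a ha, hol_one]

theorem hol_inverse {a : BiharmonicAlgebra} (ha : IsUnit a) :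
    hol (Ring.inverse a) = (hol a)⁻¹ :=
  eq_inv_of_mul_eq_one_right (hol_mul_inverse ha)

theorem nil_inverse {a : BiharmonicAlgebra} (ha : IsUnit a) :
    nil (Ring.inverse a) = - nil a / hol a ^ 2 := by
  have h1 := hol_mul_inverse ha
  have h0 : hol a ≠ 0 := left_ne_zero_of_mul_eq_one h1
  have h2 : hol a * nil (Ring.inverse a) + nil a * hol (Ring.inverse a) = 0 := by
    rw [← nil_mul, Ring.mul_inverse_cancel a ha, nil_one]
  rw [hol_inverse ha] at h2
  field_simp at h2 ⊢
  linear_combination h2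

/-! ### The biharmonic plane as a copy of `ℂ` -/

/-- The point of the biharmonic plane that corresponds to the complex number `z`. -/
def pt (z : ℂ) : BiharmonicAlgebra := point z.re z.im

@[simp] theorem hol_pt (z : ℂ) : hol (pt z) = z := by simp [pt]
@[simp] theorem nil_pt (z : ℂ) : nil (pt z) = z.im := by simp [pt]

theorem pt_add (z w : ℂ) : pt (z + w) = pt z + pt w := by
  apply ext_hol_nil <;> simp
theorem pt_sub (z w : ℂ) : pt (z - w) = pt z - pt w := by
  apply ext_hol_nil <;> simp
@[simp] theorem pt_zero : pt 0 = 0 := by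
  apply ext_hol_nil <;> simp
theorem pt_eq_zero {z : ℂ} : pt z = 0 ↔ z = 0 :=
  ⟨fun h => by simpa using congrArg hol h, fun h => by simp [h]⟩

theorem pt_mem_plane (z : ℂ) : pt z ∈ plane := ⟨_, _, rfl⟩

theorem pt_hol {ζ : BiharmonicAlgebra} (h : ζ ∈ plane) : pt (hol ζ) = ζ := by
  obtain ⟨x, y, rfl⟩ := h
  apply ext_hol_nil <;> simp

theorem isUnit_pt {z : ℂ} (h : z ≠ 0) : IsUnit (pt z) :=
  isUnit_of_mem_plane (pt_mem_plane z) (mt pt_eq_zero.1 h)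

theorem norm_pt (z : ℂ) : ‖pt z‖ = ‖z‖ := by
  have h : ‖(z.re : ℂ)‖ ^ 2 = z.re ^ 2 := by rw [norm_real, Real.norm_eq_abs, sq_abs]
  have h' : ‖(z.im : ℂ)‖ ^ 2 = z.im ^ 2 := by rw [norm_real, Real.norm_eq_abs, sq_abs]
  rw [norm_eq, re_eq, im_eq, hol_pt, nil_pt, show z - I * z.im = z.re by
    linear_combination -(re_add_im z), h, h', Complex.norm_eq_sqrt_sq_add_sq]

theorem continuous_pt : Continuous pt :=
  continuous_iff.2 ⟨by simpa using continuous_id', by simpa using by fun_prop⟩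

theorem pt_mem_openDisk {z : ℂ} : pt z ∈ openDisk ↔ z ∈ ball (0 : ℂ) 1 := by
  simp [openDisk, pt_mem_plane, norm_pt]
theorem pt_mem_closedDisk {z : ℂ} : pt z ∈ closedDisk ↔ z ∈ closedBall (0 : ℂ) 1 := by
  simp [closedDisk, pt_mem_plane, norm_pt]
theorem pt_mem_unitCircle {z : ℂ} : pt z ∈ unitCircle ↔ z ∈ sphere (0 : ℂ) 1 := by
  simp [unitCircle, pt_mem_plane, norm_pt]

theorem hol_mem_closedBall {ζ : BiharmonicAlgebra} (h : ζ ∈ closedDisk) :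
    hol ζ ∈ closedBall (0 : ℂ) 1 :=
  pt_mem_closedDisk.1 (by rwa [pt_hol h.1])

theorem continuousOn_closedDisk_iff {Φ : BiharmonicAlgebra → BiharmonicAlgebra} :
    ContinuousOn Φ closedDisk ↔ ContinuousOn (fun z => Φ (pt z)) (closedBall 0 1) := by
  refine ⟨fun h => h.comp continuous_pt.continuousOn fun z hz => pt_mem_closedDisk.2 hz,
    fun h => ?_⟩
  exact (h.comp continuous_hol.continuousOn fun ζ hζ => hol_mem_closedBall hζ).congr
    fun ζ hζ => by simp [pt_hol hζ.1]

/-! ### Monogenic functions in terms of holomorphic ones -/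

theorem nhdsWithin_plane :
    𝓝[plane \ {0}] (0 : BiharmonicAlgebra) = map pt (𝓝[≠] 0) := by
  have hemb : Topology.IsEmbedding pt :=
    Topology.IsEmbedding.of_leftInverse hol_pt continuous_hol continuous_pt
  have := hemb.map_nhdsWithin_eq {0}ᶜ 0
  rw [this, pt_zero]
  congr 1
  ext ζ
  constructor
  · rintro ⟨h, h0⟩
    refine ⟨hol ζ, fun h1 => h0 ?_, pt_hol h⟩
    rw [mem_singleton_iff] at h1 ⊢
    rw [← pt_hol h, h1, pt_zero]
  · rintro ⟨z, hz, rfl⟩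
    exact ⟨pt_mem_plane z, fun h => hz (pt_eq_zero.1 h)⟩

/-- An increment `k + (Im k) ρ` has the inverse `1/k - (Im k/k²) ρ`; the two conditions are the
coefficients of `1` and `ρ` in the difference quotient. -/
theorem hasDerivAlongPlane_iff {Φ : BiharmonicAlgebra → BiharmonicAlgebra}
    {d : BiharmonicAlgebra} {z : ℂ} :
    HasDerivAlongPlane Φ d (pt z) ↔
      HasDerivAt (fun w => hol (Φ (pt w))) (hol d) z ∧
      Tendsto (fun k : ℂ => k⁻¹ * (nil (Φ (pt (z + k))) - nil (Φ (pt z))) -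
        k.im / k * (k⁻¹ * (hol (Φ (pt (z + k))) - hol (Φ (pt z))))) (𝓝[≠] 0) (𝓝 (nil d)) := by
  rw [HasDerivAlongPlane, nhdsWithin_plane, tendsto_map'_iff, tendsto_iff,
    hasDerivAt_iff_tendsto_slope_zero]
  refine and_congr (tendsto_congr' ?_) (tendsto_congr' ?_)
  · filter_upwards [self_mem_nhdsWithin] with k hk
    simp [hol_inverse (isUnit_pt hk), pt_add, mul_comm]
  · filter_upwards [self_mem_nhdsWithin] with k hk
    have hk : k ≠ 0 := hk
    simp [hol_inverse (isUnit_pt hk), nil_inverse (isUnit_pt hk), pt_add]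
    field_simp
    ring

/-- If `g` tends to `0` at `0`, so does `Im k / k * g k`. -/
theorem tendsto_im_div_mul {g : ℂ → ℂ} (hg : Tendsto g (𝓝[≠] 0) (𝓝 0)) :
    Tendsto (fun k : ℂ => k.im / k * g k) (𝓝[≠] 0) (𝓝 0) := by
  refine squeeze_zero_norm (fun k => ?_) (tendsto_zero_iff_norm_tendsto_zero.1 hg)
  rw [norm_mul, norm_div, norm_real, Real.norm_eq_abs]
  exact mul_le_of_le_one_left (norm_nonneg _) (div_le_one_of_le₀ (abs_im_le_norm k) (norm_nonneg k))

/-- For `A` holomorphic near `z`, the function `B - Im · A'` has a complex derivative at `z` iff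
`A + B ρ` has a derivative along the plane. -/
theorem tendsto_slope_iff {A B : ℂ → ℂ} {z d : ℂ} (hA : AnalyticAt ℂ A z) :
    Tendsto (fun k : ℂ => k⁻¹ * (B (z + k) - B z) -
        k.im / k * (k⁻¹ * (A (z + k) - A z))) (𝓝[≠] 0) (𝓝 (z.im * deriv (deriv A) z + d)) ↔
      HasDerivAt (fun w => B w - w.im * deriv A w) d z := by
  have hz : Tendsto (fun k : ℂ => z + k) (𝓝[≠] 0) (𝓝 z) := by
    have : Tendsto (fun k : ℂ => z + k) (𝓝 0) (𝓝 (z + 0)) := by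
      apply Continuous.tendsto; fun_prop
    rw [add_zero] at this
    exact this.mono_left nhdsWithin_le_nhds
  have hA1 := hasDerivAt_iff_tendsto_slope_zero.1 hA.differentiableAt.hasDerivAt
  have hA2 := hasDerivAt_iff_tendsto_slope_zero.1 hA.deriv.differentiableAt.hasDerivAt
  have hA3 := hA.deriv.continuousAt.tendsto.comp hz
  -- The difference quotient of `Im w · A'(w)` involves `A'(z + k)`, whereas the condition on the
  -- left involves the slope of `A`. Both tend to `A' z`, and the factor `Im k / k` is bounded by
  -- `1`.
  have e1 : Tendsto (fun k : ℂ => k.im / k * (deriv A (z + k) - k⁻¹ * (A (z + k) - A z)))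
      (𝓝[≠] 0) (𝓝 0) := by
    apply tendsto_im_div_mul
    simpa using hA3.sub hA1
  have e2 : Tendsto (fun k : ℂ => z.im * (k⁻¹ * (deriv A (z + k) - deriv A z)))
      (𝓝[≠] 0) (𝓝 (z.im * deriv (deriv A) z)) := by
    simpa using hA2.const_mul (z.im : ℂ)
  rw [hasDerivAt_iff_tendsto_slope_zero]
  have key : ∀ k : ℂ, k ≠ 0 → k⁻¹ • (B (z + k) - (z + k).im * deriv A (z + k) -
      (B z - z.im * deriv A z)) = (k⁻¹ * (B (z + k) - B z) -
        k.im / k * (k⁻¹ * (A (z + k) - A z))) - (z.im * (k⁻¹ * (deriv A (z + k) - deriv A z)) +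
        k.im / k * (deriv A (z + k) - k⁻¹ * (A (z + k) - A z))) := by
    intro k hk
    simp only [add_im, ofReal_add, smul_eq_mul]
    field_simp
    ring
  constructor
  · intro h
    have := h.sub (e2.add e1)
    simp only [add_zero, add_sub_cancel_left] at this
    refine this.congr' ?_
    filter_upwards [self_mem_nhdsWithin] with k hk using (key k hk).symm
  · intro h
    have := h.add (e2.add e1)
    rw [add_zero, add_comm d] at this
    refine this.congr' ?_
    filter_upwards [self_mem_nhdsWithin] with k hk
    rw [key k hk]
    ring

/-- The first coordinate of the derivative makes `A` holomorphic, hence analytic, which is what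
`tendsto_slope_iff` needs to treat the second coordinate. -/
theorem isMonogenicOn_openDisk_iff {Φ : BiharmonicAlgebra → BiharmonicAlgebra} :
    IsMonogenicOn Φ openDisk ↔
      DifferentiableOn ℂ (fun z => hol (Φ (pt z))) (ball 0 1) ∧
      DifferentiableOn ℂ (fun z => nil (Φ (pt z)) - z.im * deriv (fun w => hol (Φ (pt w))) z)
        (ball 0 1) := by
  set A := fun z => hol (Φ (pt z))
  set B := fun z => nil (Φ (pt z))
  have han : DifferentiableOn ℂ A (ball 0 1) → ∀ z ∈ ball (0 : ℂ) 1, AnalyticAt ℂ A z :=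
    fun h z hz => h.analyticAt (isOpen_ball.mem_nhds hz)
  constructor
  · intro h
    have h' : ∀ z ∈ ball (0 : ℂ) 1, ∃ d, HasDerivAlongPlane Φ d (pt z) :=
      fun z hz => h _ (pt_mem_openDisk.2 hz)
    have hA : DifferentiableOn ℂ A (ball 0 1) := fun z hz => by
      obtain ⟨d, hd⟩ := h' z hz
      exact (hasDerivAlongPlane_iff.1 hd).1.differentiableAt.differentiableWithinAt
    refine ⟨hA, fun z hz => ?_⟩
    obtain ⟨d, hd⟩ := h' z hz
    have h2 := (hasDerivAlongPlane_iff.1 hd).2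
    rw [show nil d = z.im * deriv (deriv A) z + (nil d - z.im * deriv (deriv A) z) by ring] at h2
    exact ((tendsto_slope_iff (B := B) (han hA z hz)).1 h2).differentiableAt.differentiableWithinAt
  · rintro ⟨hA, hB⟩ ζ hζ
    obtain ⟨z, rfl⟩ : ∃ z, pt z = ζ := ⟨_, pt_hol hζ.1⟩
    have hz := pt_mem_openDisk.1 hζ
    have h1 := (hA.differentiableAt (isOpen_ball.mem_nhds hz)).hasDerivAt
    have h2 := (tendsto_slope_iff (B := B) (han hA z hz)).2
      (hB.differentiableAt (isOpen_ball.mem_nhds hz)).hasDerivAt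
    obtain ⟨d, hd⟩ := dualEquiv.surjective (deriv A z, z.im * deriv (deriv A) z +
      deriv (fun z => nil (Φ (pt z)) - z.im * deriv A z) z)
    rw [dualEquiv_apply, Prod.mk.injEq] at hd
    rw [← hd.1] at h1
    rw [← hd.2] at h2
    exact ⟨d, hasDerivAlongPlane_iff.2 ⟨h1, h2⟩⟩

/-! ### Boundary behaviour and the homogeneous boundary problem -/

/-- Meant for a function with two formulas: `f` is regular at `0` but says nothing on the circle,
while `g` reaches the circle but may be singular at `0`. -/
theorem exists_continuousOn_extension {f g : ℂ → ℂ} (hf : ContinuousOn f (ball 0 1))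
    (hg : ContinuousOn g (closedBall 0 1 \ {0})) (hfg : EqOn f g (ball 0 1 \ {0})) :
    ∃ H : ℂ → ℂ, ContinuousOn H (closedBall 0 1) ∧ EqOn H f (ball 0 1) ∧
      EqOn H g (sphere 0 1) := by
  classical
  have e1 : EqOn (fun z => if z ∈ ball (0 : ℂ) 1 then f z else g z) f (ball 0 1) :=
    fun z hz => if_pos hz
  have e2 : EqOn (fun z => if z ∈ ball (0 : ℂ) 1 then f z else g z) g
      (closedBall 0 1 \ {0}) := fun z hz => by
    by_cases h : z ∈ ball (0 : ℂ) 1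
    · exact (if_pos h).trans (hfg ⟨h, hz.2⟩)
    · exact if_neg h
  refine ⟨_, fun z hz => ?_, e1, fun z hz => if_neg fun h => ?_⟩
  · by_cases h : z ∈ ball (0 : ℂ) 1
    · exact ((hf.congr e1).continuousAt (isOpen_ball.mem_nhds h)).continuousWithinAt
    · have h0 : z ≠ 0 := by
        rintro rfl
        exact h (mem_ball_self one_pos)
      exact ((hg.congr e2) z ⟨hz, h0⟩).mono_of_mem_nhdsWithin
        (inter_mem_nhdsWithin _ (isOpen_compl_singleton.mem_nhds h0))
  · rw [mem_ball, mem_sphere.1 hz] at h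
    exact lt_irrefl _ h

theorem exists_diffContOnCl_extension {f g : ℂ → ℂ} (hf : DifferentiableOn ℂ f (ball 0 1))
    (hg : ContinuousOn g (closedBall 0 1 \ {0})) (hfg : EqOn f g (ball 0 1 \ {0})) :
    ∃ H : ℂ → ℂ, DiffContOnCl ℂ H (ball 0 1) ∧ EqOn H f (ball 0 1) ∧ EqOn H g (sphere 0 1) := by
  obtain ⟨H, h1, h2, h3⟩ := exists_continuousOn_extension hf.continuousOn hg hfg
  exact ⟨H, ⟨hf.congr h2, by rwa [closure_ball _ one_ne_zero]⟩, h2, h3⟩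

/-- A function that is holomorphic in the unit disk and continuous up to the circle, with real part
zero on the circle, is an imaginary constant. -/
theorem eq_const_of_re_eq_zero_on_sphere {H : ℂ → ℂ} (hH : DiffContOnCl ℂ H (ball 0 1))
    (h0 : ∀ z ∈ sphere (0 : ℂ) 1, (H z).re = 0) :
    ∃ c : ℝ, ∀ z ∈ closedBall (0 : ℂ) 1, H z = c * I := by
  have hfr : frontier (ball (0 : ℂ) 1) = sphere 0 1 := frontier_ball _ one_ne_zero
  have hcl : closure (ball (0 : ℂ) 1) = closedBall 0 1 := closure_ball _ one_ne_zero
  -- Maximum modulus for `exp G`, whose modulus is `exp (Re G)`. Applied to `H` and `-H` it gives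
  -- `Re H = 0` in the disk.
  have bound : ∀ G : ℂ → ℂ, DiffContOnCl ℂ G (ball 0 1) → (∀ z ∈ sphere (0 : ℂ) 1, (G z).re = 0) →
      ∀ z ∈ ball (0 : ℂ) 1, (G z).re ≤ 0 := by
    intro G hG hG0 z hz
    have h1 : DiffContOnCl ℂ (fun z => exp (G z)) (ball 0 1) :=
      Complex.differentiable_exp.comp_diffContOnCl hG
    have := norm_le_of_forall_mem_frontier_norm_le (C := 1) isBounded_ball h1
      (fun w hw => by rw [hfr] at hw; simp [norm_exp, hG0 w hw]) (subset_closure hz)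
    rwa [norm_exp, Real.exp_le_one_iff] at this
  have hre : ∀ z ∈ ball (0 : ℂ) 1, (H z).re = 0 := fun z hz =>
    le_antisymm (bound H hH h0 z hz) (by simpa using bound (-H) hH.neg (by simpa using h0) z hz)
  obtain ⟨c, hc⟩ := (hH.differentiableOn.analyticOnNhd
    isOpen_ball).eq_re_add_const_mul_I_of_re_eq_const hre isOpen_ball
    ⟨⟨0, mem_ball_self one_pos⟩, (convex_ball _ _).isPreconnected⟩
  refine ⟨c, fun z hz => ?_⟩
  have hEq : EqOn H (fun _ => c * I) (ball 0 1) := fun z hz => by simpa using hc z hz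
  exact hEq.of_subset_closure (hcl ▸ hH.continuousOn) continuousOn_const
    ball_subset_closedBall hcl.ge hz

/-- Cauchy's estimate for `A - A z₀` on the circle of radius `1 - ‖z‖` about `z`: continuity makes
the supremum there small, so `A' = o(1 / (1 - ‖z‖))` near `z₀`. -/
theorem tendsto_one_sub_sq_norm_mul_deriv {A : ℂ → ℂ} (hA : DiffContOnCl ℂ A (ball 0 1)) {z₀ : ℂ}
    (hz₀ : z₀ ∈ sphere (0 : ℂ) 1) :
    Tendsto (fun z : ℂ => ((1 - ‖z‖ ^ 2 : ℝ) : ℂ) * deriv A z) (𝓝[ball 0 1] z₀) (𝓝 0) := by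
  have hz₀' : ‖z₀‖ = 1 := by simpa using hz₀
  have hcont : ContinuousWithinAt A (closedBall 0 1) z₀ := by
    have := hA.continuousOn
    rw [closure_ball _ one_ne_zero] at this
    exact this z₀ (sphere_subset_closedBall hz₀)
  rw [Metric.tendsto_nhdsWithin_nhds]
  intro ε hε
  obtain ⟨δ, hδ, H⟩ := Metric.continuousWithinAt_iff.1 hcont (ε / 4) (by positivity)
  -- Since `1 - ‖z‖ ≤ dist z z₀`, the circle used lies within `2 dist z z₀ < δ` of `z₀`.
  refine ⟨δ / 2, by positivity, fun {z} hz hzd => ?_⟩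
  have hz1 : ‖z‖ < 1 := by simpa using hz
  have hR : 1 - ‖z‖ ≤ dist z z₀ := by
    rw [dist_comm, dist_eq_norm, ← hz₀']
    exact norm_sub_norm_le _ _
  have hsub : ball z (1 - ‖z‖) ⊆ ball 0 1 := ball_subset_ball' (by simp)
  have hd : DiffContOnCl ℂ (fun w => A w - A z₀) (ball z (1 - ‖z‖)) :=
    (hA.mono hsub).sub_const _
  have := norm_deriv_le_of_forall_mem_sphere_norm_le (C := ε / 4) (sub_pos.2 hz1) hd fun w hw => by
    have hw' : dist w z = 1 - ‖z‖ := hw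
    rw [← dist_eq_norm]
    refine (H ?_ ?_).le
    · rw [mem_closedBall, ← sub_add_cancel (1 : ℝ) ‖z‖, ← hw', ← dist_zero_right z]
      exact dist_triangle _ _ _
    · linarith [dist_triangle w z z₀]
  rw [deriv_sub_const] at this
  rw [dist_zero_right, norm_mul, norm_real, Real.norm_eq_abs,
    abs_of_nonneg (by nlinarith [norm_nonneg z])]
  calc (1 - ‖z‖ ^ 2) * ‖deriv A z‖ ≤ (1 - ‖z‖ ^ 2) * (ε / 4 / (1 - ‖z‖)) := by
        gcongr
        nlinarith [norm_nonneg z]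
    _ = (1 + ‖z‖) * (ε / 4) := by
        have : 1 - ‖z‖ ≠ 0 := (sub_pos.2 hz1).ne'
        field_simp
        ring
    _ < ε := by nlinarith

theorem continuousOn_one_sub_sq_norm_mul_deriv {A : ℂ → ℂ} (hA : DiffContOnCl ℂ A (ball 0 1)) :
    ∃ W : ℂ → ℂ, ContinuousOn W (closedBall 0 1) ∧
      (∀ z ∈ ball (0 : ℂ) 1, W z = ((1 - ‖z‖ ^ 2 : ℝ) : ℂ) * deriv A z) ∧
      ∀ z ∈ sphere (0 : ℂ) 1, W z = 0 := by
  classical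
  have e1 : EqOn (fun z => if z ∈ ball (0 : ℂ) 1 then ((1 - ‖z‖ ^ 2 : ℝ) : ℂ) * deriv A z else 0)
      (fun z => ((1 - ‖z‖ ^ 2 : ℝ) : ℂ) * deriv A z) (ball 0 1) := fun z hz => if_pos hz
  have e2 : ∀ z ∈ sphere (0 : ℂ) 1, z ∉ ball (0 : ℂ) 1 := fun z hz h => by
    rw [mem_ball, mem_sphere.1 hz] at h
    exact lt_irrefl _ h
  refine ⟨_, fun z hz => ?_, e1, fun z hz => if_neg (e2 z hz)⟩
  by_cases h : z ∈ ball (0 : ℂ) 1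
  · have hd : ContinuousAt (fun z : ℂ => ((1 - ‖z‖ ^ 2 : ℝ) : ℂ) * deriv A z) z := by
      refine ContinuousAt.mul (by fun_prop) ?_
      exact (hA.differentiableOn.analyticAt (isOpen_ball.mem_nhds h)).deriv.continuousAt
    exact (hd.congr (e1.symm.eventuallyEq_of_mem (isOpen_ball.mem_nhds h))).continuousWithinAt
  · have hs : z ∈ sphere (0 : ℂ) 1 := by
      rw [mem_sphere]; rw [mem_ball] at h; exact le_antisymm hz (not_lt.1 h)
    rw [← ball_union_sphere, continuousWithinAt_union]
    constructor
    · rw [ContinuousWithinAt, if_neg h]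
      exact (tendsto_one_sub_sq_norm_mul_deriv hA hs).congr'
        (e1.symm.eventuallyEq_of_mem self_mem_nhdsWithin)
    · exact continuousWithinAt_const.congr (fun w hw => if_neg (e2 w hw)) (if_neg h)

/-- The identity that trades the non-holomorphic `Im z` for a rational function of `z`, up to a
factor that vanishes on the circle. -/
theorem one_sub_sq_norm_div {z : ℂ} (hz : z ≠ 0) :
    ((1 - ‖z‖ ^ 2 : ℝ) : ℂ) / (2 * I * z) = z.im - (z - 1 / z) / (2 * I) := by
  have h : ((‖z‖ ^ 2 : ℝ) : ℂ) = conj z * z := by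
    rw [conj_mul']; push_cast; rfl
  have h2 : (z.im : ℂ) = (z - conj z) / (2 * I) := by
    rw [im_eq_sub_conj]
  rw [ofReal_sub, h, h2, ofReal_one]
  field_simp
  ring

theorem conj_eq_inv_of_mem_sphere {z : ℂ} (hz : z ∈ sphere (0 : ℂ) 1) : conj z = z⁻¹ := by
  have : ‖z‖ = 1 := by simpa using hz
  rw [Complex.inv_def, normSq_eq_norm_sq, this]
  simp

theorem ne_zero_of_mem_sphere {z : ℂ} (hz : z ∈ sphere (0 : ℂ) 1) : z ≠ 0 := by
  rintro rfl
  simp at hz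

/-- For `A` holomorphic in the disk, `B - Im · A'` holomorphic in the disk, and both continuous up
to the circle, the function `B - (1 - |z|²) A' / (2 i z) + A'(0) / (2 i z)` is holomorphic in the
disk and continuous up to the circle. -/
theorem exists_holomorphic_part {A B : ℂ → ℂ} (hA : DiffContOnCl ℂ A (ball 0 1))
    (hB : ContinuousOn B (closedBall 0 1))
    (hF : DifferentiableOn ℂ (fun z => B z - z.im * deriv A z) (ball 0 1)) :
    ∃ H : ℂ → ℂ, DiffContOnCl ℂ H (ball 0 1) ∧
      (∀ z ∈ ball (0 : ℂ) 1, H z = B z - z.im * deriv A z + z / (2 * I) * deriv A z -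
        dslope (deriv A) 0 z / (2 * I)) ∧
      ∀ z ∈ sphere (0 : ℂ) 1, H z = B z + deriv A 0 / (2 * I) * conj z := by
  obtain ⟨W, hW, hW1, hW2⟩ := continuousOn_one_sub_sq_norm_mul_deriv hA
  have hA' : DifferentiableOn ℂ (deriv A) (ball 0 1) := hA.differentiableOn.deriv isOpen_ball
  have hds : DifferentiableOn ℂ (dslope (deriv A) 0) (ball 0 1) :=
    (differentiableOn_dslope (isOpen_ball.mem_nhds (mem_ball_self one_pos))).2 hA'
  -- The term `A'(0) / (2iz)` cancels the pole at `0` that the trade creates: `(A' z - A' 0) / z` is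
  -- `dslope`, holomorphic at `0` too. The formula `g` shows the continuity up to the circle.
  obtain ⟨H, h1, h2, h3⟩ := exists_diffContOnCl_extension
    (f := fun z => B z - z.im * deriv A z + z / (2 * I) * deriv A z -
        dslope (deriv A) 0 z / (2 * I))
    (g := fun z => B z - W z / (2 * I * z) + deriv A 0 / (2 * I * z))
    ((hF.add ((differentiableOn_id.div_const _).mul hA')).sub (hds.div_const _))
    (by
      have hne : ∀ z ∈ closedBall (0 : ℂ) 1 \ {0}, 2 * I * z ≠ 0 := fun z hz =>
        mul_ne_zero (mul_ne_zero two_ne_zero I_ne_zero) hz.2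
      have hc : ContinuousOn (fun z : ℂ => 2 * I * z) (closedBall (0 : ℂ) 1 \ {0}) := by fun_prop
      exact ((hB.mono sdiff_subset).sub ((hW.mono sdiff_subset).div hc hne)).add
        (continuousOn_const.div hc hne))
    (by
      rintro z ⟨hz, h0⟩
      have h0 : z ≠ 0 := h0
      have := one_sub_sq_norm_div h0
      simp only [hW1 z hz, dslope_of_ne _ h0, slope_def_field, sub_zero]
      rw [mul_div_right_comm, this]
      field_simp
      ring)
  refine ⟨H, h1, h2, fun z hz => ?_⟩
  refine (h3 hz).trans ?_
  simp only [hW2 z hz, conj_eq_inv_of_mem_sphere hz]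
  have := ne_zero_of_mem_sphere hz
  field_simp
  ring

/-- With `g = A'(0)/(2i)`, the holomorphic part `H` equals `B + g z̄` on the circle, and `Re (g z̄)
= Re (ḡ z)`. So `Re B` determines `H` up to an imaginary constant, hence `B` on the circle; then `Re
A` is known there and `A` is affine. Comparing its slope with `2ig` closes the argument. -/
theorem boundary_uniqueness {A B : ℂ → ℂ} {l : ℝ} (hA : DiffContOnCl ℂ A (ball 0 1))
    (hB : ContinuousOn B (closedBall 0 1))
    (hF : DifferentiableOn ℂ (fun z => B z - z.im * deriv A z) (ball 0 1))
    (h₁ : ∀ z ∈ sphere (0 : ℂ) 1, (A z).re + (B z).im = -l * z.im)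
    (h₃ : ∀ z ∈ sphere (0 : ℂ) 1, (B z).re = l * z.re) :
    l = 0 ∧ ∃ a a₁ a₂ : ℝ, ∀ z ∈ ball (0 : ℂ) 1,
      A z = I * (a * z + a₁ + a₂ * I) ∧ B z = I * (a * z.im + a₂) := by
  obtain ⟨H, hH, hH1, hH2⟩ := exists_holomorphic_part hA hB hF
  set g := deriv A 0 / (2 * I) with hg
  have hid : ∀ c : ℂ, DiffContOnCl ℂ (fun z : ℂ => c * z) (ball 0 1) := fun c =>
    (differentiable_id.const_mul c).diffContOnCl
  obtain ⟨c, hc⟩ := eq_const_of_re_eq_zero_on_sphere (hH.sub (hid (l + conj g))) fun z hz => by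
    simp [hH2 z hz, h₃ z hz]
    ring
  obtain ⟨c', hc'⟩ := eq_const_of_re_eq_zero_on_sphere
      ((hA.sub (hid (2 * I * (l + conj g)))).add_const (c : ℂ)) fun z hz => by
    have e1 := h₁ z hz
    have e2 : B z = (l + conj g) * z + c * I - g * conj z := by
      have := hc z (sphere_subset_closedBall hz)
      simp only [Pi.sub_apply, hH2 z hz] at this
      linear_combination this
    rw [e2] at e1
    simp at e1 ⊢
    linarith
  have hAz : ∀ z ∈ ball (0 : ℂ) 1, A z = 2 * I * (l + conj g) * z + (c' * I - c) := fun z hz => by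
    have := hc' z (ball_subset_closedBall hz)
    simp only [Pi.sub_apply] at this
    linear_combination this
  have hA' : ∀ z ∈ ball (0 : ℂ) 1, deriv A z = 2 * I * (l + conj g) := fun z hz => by
    have : A =ᶠ[𝓝 z] fun z => 2 * I * (l + conj g) * z + (c' * I - c) :=
      EqOn.eventuallyEq_of_mem hAz (isOpen_ball.mem_nhds hz)
    rw [this.deriv_eq, deriv_add_const, deriv_const_mul_field]
    simp
  have h00 : (0 : ℂ) ∈ ball (0 : ℂ) 1 := mem_ball_self one_pos
  -- The slope of `A` found above is `2i (l + ḡ)`, while `g` is `A'(0)/(2i)` by definition. Real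
  -- parts give `l = 0`; imaginary parts then show that `g` is real.
  have hgg : g = l + conj g := by
    have := hA' 0 h00
    refine hg.trans ?_
    rw [this]
    generalize (l : ℂ) + conj g = w
    field_simp
  have hl : l = 0 := by
    have := congrArg re hgg
    simp at this
    exact this
  have hgr : g = g.re := by
    rw [hl] at hgg
    apply Complex.ext
    · simp
    · have := congrArg im hgg
      simp at this
      simp
      linarith
  have hdd : deriv (deriv A) 0 = 0 := by
    have : deriv A =ᶠ[𝓝 0] fun z => 2 * I * (l + conj g) :=
      EqOn.eventuallyEq_of_mem hA' (isOpen_ball.mem_nhds h00)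
    rw [this.deriv_eq, deriv_const]
  refine ⟨hl, 2 * g.re, c', c, fun z hz => ⟨?_, ?_⟩⟩
  · rw [hAz z hz, ← hgg]
    push_cast
    rw [← hgr]
    linear_combination (-(c : ℂ)) * I_sq
  · have e1 := hH1 z hz
    have e2 := hc z (ball_subset_closedBall hz)
    have e3 : dslope (deriv A) 0 z = 0 := by
      by_cases h : z = 0
      · rw [h, dslope_same, hdd]
      · rw [dslope_of_ne _ h, slope_def_field, hA' z hz, hA' 0 h00, sub_self, zero_div]
    rw [e3, hA' z hz, ← hgg] at e1
    simp only [Pi.sub_apply, ← hgg, e1] at e2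
    push_cast
    rw [← hgr]
    have e4 : z / (2 * I) * (2 * I * g) = g * z := by
      clear_value g
      field_simp
    rw [e4] at e2
    linear_combination e2

/-! ### The Dini condition -/

section Dini

variable {E : Type} [PseudoEMetricSpace E]

theorem modulusOfContinuity_mono (f : BiharmonicAlgebra → E) :
    Monotone (modulusOfContinuity f) := by
  intro a b hab
  unfold modulusOfContinuity
  gcongr with τ₁ _ τ₂ _
  exact iSup_const_mono fun h => h.trans hab

theorem edist_le_modulusOfContinuity (f : BiharmonicAlgebra → E) {τ₁ τ₂ : BiharmonicAlgebra}
    {ε : ℝ} (h₁ : τ₁ ∈ unitCircle) (h₂ : τ₂ ∈ unitCircle) (h : ‖τ₁ - τ₂‖ ≤ ε) :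
    edist (f τ₁) (f τ₂) ≤ modulusOfContinuity f ε :=
  le_iSup₂_of_le τ₁ h₁ (le_iSup₂_of_le τ₂ h₂ (le_iSup_of_le h le_rfl))

theorem modulusOfContinuity_le {f : BiharmonicAlgebra → E} {ε : ℝ} {C : ENNReal}
    (h : ∀ τ₁ ∈ unitCircle, ∀ τ₂ ∈ unitCircle, ‖τ₁ - τ₂‖ ≤ ε → edist (f τ₁) (f τ₂) ≤ C) :
    modulusOfContinuity f ε ≤ C :=
  iSup₂_le fun τ₁ h₁ => iSup₂_le fun τ₂ h₂ => iSup_le fun h' => h τ₁ h₁ τ₂ h₂ h'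

theorem lintegral_inv_Ioc : ∫⁻ η in Ioc (0 : ℝ) 1, (ENNReal.ofReal η)⁻¹ = ⊤ := by
  by_contra h
  have h1 : IntegrableOn (fun x : ℝ => ((ENNReal.ofReal x)⁻¹).toReal) (Ioc 0 1) :=
    integrable_toReal_of_lintegral_ne_top (by fun_prop) h
  have h2 : IntegrableOn (fun x : ℝ => x⁻¹) (Ioc 0 1) := by
    refine h1.congr_fun (fun x hx => ?_) measurableSet_Ioc
    simp [ENNReal.toReal_inv, hx.1.le]
  rw [← intervalIntegrable_iff_integrableOn_Ioc_of_le zero_le_one, intervalIntegrable_inv_iff] at h2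
  simp at h2

/-- A modulus bounded below by `c > 0` would make the Dini integral at least `c ∫₀¹ dη/η = ∞`. -/
theorem IsDini.exists_modulusOfContinuity_le {f : BiharmonicAlgebra → E} (hf : IsDini f)
    {c : ENNReal} (hc : 0 < c) : ∃ η : ℝ, 0 < η ∧ modulusOfContinuity f η ≤ c := by
  by_contra! H
  refine hf.ne (top_le_iff.1 ?_)
  calc ⊤ = c * ∫⁻ η in Ioc (0 : ℝ) 1, (ENNReal.ofReal η)⁻¹ := by
        rw [lintegral_inv_Ioc, ENNReal.mul_top hc.ne']
    _ ≤ ∫⁻ η in Ioc (0 : ℝ) 1, c * (ENNReal.ofReal η)⁻¹ := lintegral_const_mul_le _ _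
    _ ≤ _ := by
        refine setLIntegral_mono' measurableSet_Ioc fun η hη => ?_
        rw [div_eq_mul_inv]
        exact mul_le_mul_left (H η hη.1).le _

theorem IsDini.continuousOn {f : BiharmonicAlgebra → E} (hf : IsDini f) :
    ContinuousOn f unitCircle := by
  intro τ hτ
  rw [ContinuousWithinAt, EMetric.tendsto_nhds]
  intro ε hε
  obtain ⟨c, hc0, hcε⟩ := exists_between hε
  obtain ⟨η, hη, h⟩ := hf.exists_modulusOfContinuity_le hc0
  filter_upwards [self_mem_nhdsWithin, mem_nhdsWithin_of_mem_nhds (ball_mem_nhds τ hη)] with σ h1 h2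
  rw [mem_ball, dist_eq_norm] at h2
  exact ((edist_le_modulusOfContinuity f h1 hτ h2.le).trans h).trans_lt hcε

end Dini

/-! ### The classical Schwarz integral up to the boundary -/

theorem pt_circleMap (θ : ℝ) : pt (circleMap 0 1 θ) = point (Real.cos θ) (Real.sin θ) := by
  rw [pt, circleMap_zero_re, circleMap_zero_im, one_mul, one_mul]

theorem circleMap_mem_unitSphere (θ : ℝ) : circleMap 0 1 θ ∈ sphere (0 : ℂ) 1 :=
  circleMap_mem_sphere 0 zero_le_one θ

section SchwarzIntegral

variable {u : BiharmonicAlgebra → ℝ}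

theorem IsDini.continuousOn_sphere (hu : IsDini u) :
    ContinuousOn (fun z => u (pt z)) (sphere 0 1) :=
  hu.continuousOn.comp continuous_pt.continuousOn fun _ hz => pt_mem_unitCircle.2 hz

theorem IsDini.exists_bound (hu : IsDini u) : ∃ M : ℝ, ∀ z ∈ sphere (0 : ℂ) 1, |u (pt z)| ≤ M :=
  (isCompact_sphere (0 : ℂ) 1).exists_bound_of_continuousOn hu.continuousOn_sphere

theorem IsDini.modulusOfContinuity_bounded (hu : IsDini u) :
    ∃ M : ℝ, ∀ η, modulusOfContinuity u η ≤ ENNReal.ofReal M := by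
  obtain ⟨M, hM⟩ := hu.exists_bound
  have hM' : ∀ τ ∈ unitCircle, |u τ| ≤ M := fun τ hτ => by
    have := hM (hol τ) (pt_mem_unitCircle.1 (by rwa [pt_hol hτ.1]))
    rwa [pt_hol hτ.1] at this
  refine ⟨2 * M, fun η => modulusOfContinuity_le fun τ₁ h₁ τ₂ h₂ _ => ?_⟩
  rw [edist_dist, Real.dist_eq]
  refine ENNReal.ofReal_le_ofReal ?_
  linarith [abs_sub (u τ₁) (u τ₂), hM' τ₁ h₁, hM' τ₂ h₂]

theorem IsDini.abs_sub_le (hu : IsDini u) {z w : ℂ} {η : ℝ} (hz : z ∈ sphere (0 : ℂ) 1)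
    (hw : w ∈ sphere (0 : ℂ) 1) (h : ‖z - w‖ ≤ η) :
    |u (pt z) - u (pt w)| ≤ (modulusOfContinuity u η).toReal := by
  obtain ⟨M, hM⟩ := hu.modulusOfContinuity_bounded
  have := edist_le_modulusOfContinuity u (pt_mem_unitCircle.2 hz) (pt_mem_unitCircle.2 hw)
    (ε := η) (by rwa [← pt_sub, norm_pt])
  rw [edist_dist, Real.dist_eq] at this
  exact (ENNReal.ofReal_le_iff_le_toReal ((hM η).trans_lt ENNReal.ofReal_lt_top).ne).1 this

/-- The majorant for dominated convergence. The Dini condition covers `(0, 1]`; beyond `1` the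
modulus is bounded, and evenness gives negative `θ`. -/
theorem IsDini.intervalIntegrable (hu : IsDini u) (a b : ℝ) :
    IntervalIntegrable (fun θ : ℝ => (modulusOfContinuity u |θ|).toReal / |θ|) volume a b := by
  have hmeas : Measurable (modulusOfContinuity u) := (modulusOfContinuity_mono u).measurable
  have hm : Measurable (fun θ : ℝ => (modulusOfContinuity u |θ|).toReal / |θ|) := by
    have : Measurable (fun θ : ℝ => |θ|) := by fun_prop
    exact (hmeas.comp this).ennreal_toReal.div this
  have h1 : IntegrableOn (fun θ : ℝ => (modulusOfContinuity u |θ|).toReal / |θ|) (Ioc 0 1) := by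
    have : IntegrableOn (fun θ : ℝ => (modulusOfContinuity u θ / ENNReal.ofReal θ).toReal)
        (Ioc 0 1) :=
      integrable_toReal_of_lintegral_ne_top (by fun_prop) hu.ne
    refine this.congr_fun (fun x hx => ?_) measurableSet_Ioc
    simp only [ENNReal.toReal_div]
    rw [ENNReal.toReal_ofReal hx.1.le, abs_of_pos hx.1]
  obtain ⟨M, hM⟩ := hu.modulusOfContinuity_bounded
  have h2 : ∀ x : ℝ, IntegrableOn (fun θ : ℝ => (modulusOfContinuity u |θ|).toReal / |θ|)
      (Ioc 1 x) := fun x => by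
    refine Measure.integrableOn_of_bounded measure_Ioc_lt_top.ne hm.aestronglyMeasurable
      (M := (ENNReal.ofReal M).toReal) (ae_restrict_of_forall_mem measurableSet_Ioc fun θ hθ => ?_)
    have h0 : 1 ≤ |θ| := hθ.1.le.trans (le_abs_self θ)
    rw [Real.norm_of_nonneg (by positivity)]
    exact (div_le_self ENNReal.toReal_nonneg h0).trans
      (ENNReal.toReal_mono ENNReal.ofReal_ne_top (hM _))
  refine intervalIntegrable_of_even (fun x => by rw [abs_neg]) fun x hx => ?_
  rw [intervalIntegrable_iff_integrableOn_Ioc_of_le hx.le]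
  exact (h1.union (h2 x)).mono_set fun y hy => (le_or_gt y 1).imp (fun h => ⟨hy.1, h⟩)
    fun h => ⟨h, hy.2⟩

theorem norm_circleMap_sub_one_le (θ : ℝ) : ‖circleMap 0 1 θ - 1‖ ≤ |θ| := by
  rw [circleMap_zero, ofReal_one, one_mul, mul_comm]
  exact Real.norm_exp_I_mul_ofReal_sub_one_le

/-- Uniformly in `r`: `1 - r ≤ |t - r|` gives `|t - 1| ≤ 2 |t - r|`, and `|t - 1| = 2 |sin (θ/2)| ≥
2|θ|/π` by Jordan's inequality. -/
theorem abs_le_mul_norm_circleMap_sub {θ r : ℝ} (hθ : |θ| ≤ π) (hr : 0 ≤ r) (hr1 : r ≤ 1) :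
    |θ| ≤ π * ‖circleMap 0 1 θ - r‖ := by
  have h1 : ‖circleMap 0 1 θ - 1‖ ≤ 2 * ‖circleMap 0 1 θ - r‖ := by
    have ha : ‖circleMap 0 1 θ - 1‖ ≤ ‖circleMap 0 1 θ - r‖ + ‖(r : ℂ) - 1‖ :=
      norm_sub_le_norm_sub_add_norm_sub _ _ _
    have hb : ‖(r : ℂ) - 1‖ = 1 - r := by
      rw [← ofReal_one, ← ofReal_sub, norm_real, Real.norm_eq_abs, abs_sub_comm,
        abs_of_nonneg (sub_nonneg.2 hr1)]
    have hc : 1 - r ≤ ‖circleMap 0 1 θ - r‖ := by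
      have := norm_sub_norm_le (circleMap 0 1 θ) r
      rwa [norm_circleMap_zero, abs_one, norm_real, Real.norm_of_nonneg hr] at this
    linarith
  have h2 : ‖circleMap 0 1 θ - 1‖ = 2 * |Real.sin (θ / 2)| := by
    rw [circleMap_zero, ofReal_one, one_mul, mul_comm, norm_exp_I_mul_ofReal_sub_one]
    simp
  have h3 := Real.mul_abs_le_abs_sin (x := θ / 2) (by
    rw [abs_div, abs_two]; linarith)
  rw [abs_div, abs_two] at h3
  have h4 : 2 / π * |θ| ≤ 2 * ‖circleMap 0 1 θ - r‖ := by
    calc 2 / π * |θ| = 2 * (2 / π * (|θ| / 2)) := by ring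
      _ ≤ _ := by linarith
  have := Real.pi_pos
  rw [div_mul_eq_mul_div, div_le_iff₀ this] at h4
  linarith

theorem circleMap_ne_of_mem_ball {z : ℂ} (hz : z ∈ ball (0 : ℂ) 1) (θ : ℝ) :
    circleMap 0 1 θ - z ≠ 0 := by
  intro h
  rw [← sub_eq_zero.1 h] at hz
  simp at hz

theorem intervalIntegral_circleMap_div_sub {z : ℂ} (hz : z ∈ ball (0 : ℂ) 1) :
    ∫ θ in (0 : ℝ)..2 * π, circleMap 0 1 θ / (circleMap 0 1 θ - z) = 2 * π := by
  have := circleIntegral.integral_sub_inv_of_mem_ball hz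
  simp only [circleIntegral, deriv_circleMap, smul_eq_mul] at this
  have h2 : ∀ θ : ℝ, circleMap 0 1 θ * I * (circleMap 0 1 θ - z)⁻¹ =
      I * (circleMap 0 1 θ / (circleMap 0 1 θ - z)) := fun θ => by ring
  simp only [h2, intervalIntegral.integral_const_mul] at this
  exact mul_left_cancel₀ I_ne_zero (this.trans (by ring))

theorem continuous_circleMap_div_sub {z : ℂ} (hz : z ∈ ball (0 : ℂ) 1) :
    Continuous fun θ : ℝ => (circleMap 0 1 θ + z) / (circleMap 0 1 θ - z) := by
  have := circleMap_ne_of_mem_ball hz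
  fun_prop (disch := simpa using this)

theorem intervalIntegral_schwarzKernel {z : ℂ} (hz : z ∈ ball (0 : ℂ) 1) :
    ∫ θ in (0 : ℝ)..2 * π, (circleMap 0 1 θ + z) / (circleMap 0 1 θ - z) = 2 * π := by
  have h1 : ∀ θ : ℝ, (circleMap 0 1 θ + z) / (circleMap 0 1 θ - z) =
      2 * (circleMap 0 1 θ / (circleMap 0 1 θ - z)) - 1 := fun θ => by
    have := circleMap_ne_of_mem_ball hz θ
    field_simp
    ring
  have hc : Continuous fun θ : ℝ => circleMap 0 1 θ / (circleMap 0 1 θ - z) := by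
    have := circleMap_ne_of_mem_ball hz
    fun_prop (disch := simpa using this)
  simp only [h1]
  rw [intervalIntegral.integral_sub ((hc.intervalIntegrable _ _).const_mul 2)
    intervalIntegrable_const, intervalIntegral.integral_const_mul,
    intervalIntegral_circleMap_div_sub hz]
  simp
  ring

/-- Rotating a circle integral by a point `w` of the circle. -/
theorem intervalIntegral_rotate (f : ℂ → ℂ) {w : ℂ} (hw : w ∈ sphere (0 : ℂ) 1) :
    ∫ θ in (0 : ℝ)..2 * π, f (circleMap 0 1 θ) =
      ∫ θ in (-π)..π, f (w * circleMap 0 1 θ) := by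
  have hw' : ‖w‖ = 1 := by simpa using hw
  have hper : Function.Periodic (fun θ => f (circleMap 0 1 θ)) (2 * π) :=
    (periodic_circleMap 0 1).comp f
  have h1 : w = circleMap 0 1 (arg w) := by
    rw [circleMap_zero, ← hw', norm_mul_exp_arg_mul_I]
  have h2 : ∀ θ : ℝ, f (w * circleMap 0 1 θ) = f (circleMap 0 1 (θ + arg w)) := fun θ => by
    conv_lhs => rw [h1, circleMap_zero_mul, one_mul, add_comm]
  simp only [h2]
  rw [intervalIntegral.integral_comp_add_right (fun θ => f (circleMap 0 1 θ))]
  have := hper.intervalIntegral_add_eq 0 (-π + arg w)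
  rw [zero_add] at this
  rw [this]
  congr 1
  ring

/-- The classical Schwarz integral for the unit disk. -/
def schwarzIntegral (f : ℂ → ℂ) (z : ℂ) : ℂ :=
  (2 * π : ℂ)⁻¹ * ∫ θ in (0 : ℝ)..2 * π,
    f (circleMap 0 1 θ) * ((circleMap 0 1 θ + z) / (circleMap 0 1 θ - z))

/-- The function that extends the Schwarz integral of `u` to the closed disk. -/
def schwarzExtension (u : BiharmonicAlgebra → ℝ) (z : ℂ) : ℂ :=
  u (pt (z / ‖z‖)) + (2 * π : ℂ)⁻¹ * ∫ θ in (-π)..π,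
    ((u (pt (z / ‖z‖ * circleMap 0 1 θ)) - u (pt (z / ‖z‖)) : ℝ) : ℂ) *
      ((circleMap 0 1 θ + ‖z‖) / (circleMap 0 1 θ - ‖z‖))

theorem div_norm_mem_sphere {z : ℂ} (h : z ≠ 0) : z / ‖z‖ ∈ sphere (0 : ℂ) 1 := by
  simp [h]

theorem mul_circleMap_mem_sphere {w : ℂ} (hw : w ∈ sphere (0 : ℂ) 1) (θ : ℝ) :
    w * circleMap 0 1 θ ∈ sphere (0 : ℂ) 1 := by
  have hw' : ‖w‖ = 1 := by simpa using hw
  simp [hw']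

theorem IsDini.continuous_comp_mul_circleMap (hu : IsDini u) {w : ℂ} (hw : w ∈ sphere (0 : ℂ) 1) :
    Continuous fun θ : ℝ => u (pt (w * circleMap 0 1 θ)) :=
  hu.continuousOn_sphere.comp_continuous (by fun_prop) (mul_circleMap_mem_sphere hw)

theorem IsDini.continuous_comp_circleMap (hu : IsDini u) :
    Continuous fun θ : ℝ => u (pt (circleMap 0 1 θ)) :=
  hu.continuousOn_sphere.comp_continuous (by fun_prop) circleMap_mem_unitSphere

/-- Rotating by `z / |z|` makes the kernel depend on `|z|` only; the constant `u (z / |z|)` can be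
split off because the kernel has mean `1`. -/
theorem IsDini.schwarzExtension_eq (hu : IsDini u) {z : ℂ} (hz : z ∈ ball (0 : ℂ) 1)
    (h0 : z ≠ 0) : schwarzExtension u z = schwarzIntegral (fun t => u (pt t)) z := by
  set w := z / ‖z‖ with hw
  have hws : w ∈ sphere (0 : ℂ) 1 := div_norm_mem_sphere h0
  have hw0 : w ≠ 0 := ne_zero_of_mem_sphere hws
  have hzw : z = w * ‖z‖ := by
    rw [hw, div_mul_cancel₀]
    simpa using h0
  have hr : (‖z‖ : ℂ) ∈ ball (0 : ℂ) 1 := by simpa using hz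
  have hK := continuous_circleMap_div_sub hr
  have hU := hu.continuous_comp_mul_circleMap hws
  have hone := intervalIntegral_schwarzKernel hr
  rw [intervalIntegral_rotate (fun t => (t + ‖z‖) / (t - ‖z‖)) (w := 1) (by simp)] at hone
  simp only [one_mul] at hone
  have hquot : ∀ t : ℂ, (w * t + z) / (w * t - z) = (t + ‖z‖) / (t - ‖z‖) := fun t => by
    conv_lhs => rw [hzw, ← mul_add, ← mul_sub, mul_div_mul_left _ _ hw0]
  have hS : schwarzIntegral (fun t => u (pt t)) z = (2 * π : ℂ)⁻¹ * ∫ θ in (-π)..π,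
      (u (pt (w * circleMap 0 1 θ)) : ℂ) *
        ((circleMap 0 1 θ + ‖z‖) / (circleMap 0 1 θ - ‖z‖)) := by
    rw [schwarzIntegral, intervalIntegral_rotate (fun t => (u (pt t) : ℂ) * ((t + z) / (t - z))) hws]
    simp only [hquot]
  have hpi : (2 * π : ℂ) ≠ 0 := by exact_mod_cast Real.two_pi_pos.ne'
  rw [hS, schwarzExtension, ← hw]
  simp only [ofReal_sub, sub_mul]
  rw [intervalIntegral.integral_sub, intervalIntegral.integral_const_mul, hone]
  · field_simp
    ring
  · exact ((continuous_ofReal.comp hU).mul hK).intervalIntegrable _ _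
  · exact (continuous_const.mul hK).intervalIntegrable _ _

/-- For `|z| = 1` the kernel `(t + 1) / (t - 1)` is purely imaginary, so the integral term
contributes nothing to the real part. -/
theorem re_schwarzExtension {z : ℂ} (hz : z ∈ sphere (0 : ℂ) 1) :
    (schwarzExtension u z).re = u (pt z) := by
  have hz' : ‖z‖ = 1 := by simpa using hz
  have hker : ∀ θ : ℝ, ∃ x : ℝ, (circleMap 0 1 θ + 1) / (circleMap 0 1 θ - 1) = x * I := fun θ => by
    refine ⟨((circleMap 0 1 θ + 1) / (circleMap 0 1 θ - 1)).im, ?_⟩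
    have hs := circleMap_mem_unitSphere θ
    have h0 := ne_zero_of_mem_sphere hs
    have hc := conj_eq_inv_of_mem_sphere hs
    have : ((circleMap 0 1 θ + 1) / (circleMap 0 1 θ - 1)).re = 0 := by
      -- At `t = 1` division by zero makes the kernel `0`.
      by_cases h1 : circleMap 0 1 θ - 1 = 0
      · simp [h1]
      · have h2 : 1 - circleMap 0 1 θ ≠ 0 := fun h => h1 (by linear_combination -h)
        have := re_eq_add_conj ((circleMap 0 1 θ + 1) / (circleMap 0 1 θ - 1))
        rw [map_div₀, map_add, map_sub, hc, map_one] at this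
        have h3 : (circleMap 0 1 θ)⁻¹ - 1 = (1 - circleMap 0 1 θ) / circleMap 0 1 θ := by
          field_simp
        rw [h3] at this
        have h4 : (circleMap 0 1 θ + 1) / (circleMap 0 1 θ - 1) + ((circleMap 0 1 θ)⁻¹ + 1) /
            ((1 - circleMap 0 1 θ) / circleMap 0 1 θ) = 0 := by
          field_simp
          ring
        rw [h4, zero_div] at this
        exact_mod_cast this
    apply Complex.ext <;> simp [this]
  choose k hk using hker
  rw [schwarzExtension, hz']
  simp only [ofReal_one, div_one, hk]
  have : ∀ θ : ℝ, ((u (pt (z * circleMap 0 1 θ)) - u (pt z) : ℝ) : ℂ) * (k θ * I) =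
      (((u (pt (z * circleMap 0 1 θ)) - u (pt z)) * k θ : ℝ) : ℂ) * I := fun θ => by
    push_cast
    ring
  simp only [this]
  rw [intervalIntegral.integral_mul_const, intervalIntegral.integral_ofReal,
    show (2 * π : ℂ) = ((2 * π : ℝ) : ℂ) by push_cast; rfl, ← ofReal_inv, ← mul_assoc,
    ← ofReal_mul]
  simp

/-- Dominated convergence: the integrand is at most `2π ω(|θ|)/|θ|`, uniformly in `z`. This is where
the Dini condition, rather than mere continuity of `u`, is needed. -/
theorem IsDini.continuousOn_schwarzExtension (hu : IsDini u) :
    ContinuousOn (schwarzExtension u) (closedBall 0 1 \ {0}) := by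
  have hw : ContinuousOn (fun z : ℂ => z / ‖z‖) (closedBall 0 1 \ {0}) := by
    refine continuousOn_id.div (by fun_prop) fun z hz => ?_
    simpa using hz.2
  have hwm : ∀ z ∈ closedBall (0 : ℂ) 1 \ {0}, z / ‖z‖ ∈ sphere (0 : ℂ) 1 :=
    fun z hz => div_norm_mem_sphere hz.2
  have hc := continuous_ofReal.comp_continuousOn (hu.continuousOn_sphere.comp hw hwm)
  refine hc.add (continuousOn_const.mul ?_)
  simp only [intervalIntegral.integral_of_le (neg_le_self Real.pi_pos.le)]
  have hint := ((hu.intervalIntegrable (-π) π).const_mul (2 * π)).1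
  refine continuousOn_of_dominated (fun z hz => ?_)
    (fun z hz => ae_restrict_of_forall_mem measurableSet_Ioc fun θ hθ => ?_) hint ?_
  · have h1 := hu.continuous_comp_mul_circleMap (hwm z hz)
    refine (continuous_ofReal.comp (h1.sub continuous_const)).aestronglyMeasurable.mul ?_
    exact (Measurable.div (by fun_prop) (by fun_prop)).aestronglyMeasurable
  · have hr : ‖z‖ ≤ 1 := by simpa using hz.1
    have hθ' : |θ| ≤ π := abs_le.2 ⟨hθ.1.le, hθ.2⟩
    have hd := abs_le_mul_norm_circleMap_sub hθ' (norm_nonneg z) hr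
    have hws := hwm z hz
    have hw1 : ‖z / ‖z‖‖ = 1 := by simpa using hws
    have hn : ‖circleMap 0 1 θ + ‖z‖‖ ≤ 2 := by
      refine (norm_add_le _ _).trans ?_
      rw [norm_circleMap_zero, norm_real, norm_norm, abs_one]
      linarith
    have hsub : |u (pt (z / ‖z‖ * circleMap 0 1 θ)) - u (pt (z / ‖z‖))| ≤
        (modulusOfContinuity u |θ|).toReal := by
      refine hu.abs_sub_le (mul_circleMap_mem_sphere hws θ) hws ?_
      rw [← mul_sub_one, norm_mul, hw1, one_mul]
      exact norm_circleMap_sub_one_le θ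
    rw [norm_mul, norm_real, Real.norm_eq_abs, norm_div]
    -- At `θ = 0` both sides are `0`: the difference of `u` vanishes, and the majorant is a division
    -- by zero.
    rcases eq_or_ne θ 0 with rfl | hθ0
    · simp [circleMap_zero]
    · have hpos : 0 < |θ| := abs_pos.2 hθ0
      have hpos2 : 0 < ‖circleMap 0 1 θ - ‖z‖‖ :=
        pos_of_mul_pos_right (hpos.trans_le hd) Real.pi_pos.le
      have hq : ‖circleMap 0 1 θ + ‖z‖‖ / ‖circleMap 0 1 θ - ‖z‖‖ ≤ 2 * π / |θ| := by
        rw [div_le_div_iff₀ hpos2 hpos]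
        nlinarith [Real.pi_pos, norm_nonneg (circleMap 0 1 θ + ‖z‖)]
      calc _ ≤ (modulusOfContinuity u |θ|).toReal * (2 * π / |θ|) := by gcongr
        _ = _ := by ring
  · have hne : ∀ᵐ θ : ℝ ∂(volume.restrict (Ioc (-π) π)), θ ≠ 0 :=
      ae_restrict_of_ae (Measure.ae_ne volume 0)
    filter_upwards [hne, ae_restrict_mem measurableSet_Ioc] with θ h0 hθ
    have hθ' : |θ| ≤ π := abs_le.2 ⟨hθ.1.le, hθ.2⟩
    have hc2 : ContinuousOn (fun z : ℂ => u (pt (z / ‖z‖ * circleMap 0 1 θ)))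
        (closedBall 0 1 \ {0}) :=
      hu.continuousOn_sphere.comp (hw.mul continuousOn_const)
        fun z hz => mul_circleMap_mem_sphere (hwm z hz) θ
    refine ContinuousOn.mul (continuous_ofReal.comp_continuousOn
      (hc2.sub (hu.continuousOn_sphere.comp hw hwm)))
      (ContinuousOn.div (by fun_prop) (by fun_prop) fun z hz h => ?_)
    have hr : ‖z‖ ≤ 1 := by simpa using hz.1
    have hd := abs_le_mul_norm_circleMap_sub hθ' (norm_nonneg z) hr
    rw [h, norm_zero, mul_zero] at hd
    exact h0 (abs_nonpos_iff.1 hd)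

end SchwarzIntegral

/-! ### Stability of the Dini condition -/

section DiniOperations

variable {E F : Type} [NormedAddCommGroup E] [NormedAddCommGroup F]

theorem IsDini.add {f g : BiharmonicAlgebra → E} (hf : IsDini f) (hg : IsDini g) :
    IsDini (fun τ => f τ + g τ) := by
  have hm : Measurable (modulusOfContinuity f) := (modulusOfContinuity_mono f).measurable
  refine lt_of_le_of_lt ?_ (ENNReal.add_lt_top.2 ⟨hf, hg⟩)
  rw [← lintegral_add_left (by fun_prop)]
  refine lintegral_mono fun η => ?_
  rw [← ENNReal.add_div]
  refine ENNReal.div_le_div_right (modulusOfContinuity_le fun τ₁ h₁ τ₂ h₂ h => ?_) _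
  exact (edist_add_add_le _ _ _ _).trans (add_le_add (edist_le_modulusOfContinuity f h₁ h₂ h)
    (edist_le_modulusOfContinuity g h₁ h₂ h))

theorem IsDini.of_edist_le {f : BiharmonicAlgebra → F} {g : BiharmonicAlgebra → E} {K : NNReal}
    (hg : IsDini g) (h : ∀ τ₁ τ₂, edist (f τ₁) (f τ₂) ≤ K * edist (g τ₁) (g τ₂)) : IsDini f := by
  refine lt_of_le_of_lt ?_ (ENNReal.mul_lt_top (ENNReal.coe_lt_top (r := K)) hg)
  rw [← lintegral_const_mul' _ _ ENNReal.coe_ne_top]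
  refine lintegral_mono fun η => ?_
  rw [← mul_div_assoc]
  refine ENNReal.div_le_div_right (modulusOfContinuity_le fun τ₁ h₁ τ₂ h₂ h' => ?_) _
  exact (h τ₁ τ₂).trans (mul_le_mul_right (edist_le_modulusOfContinuity g h₁ h₂ h') _)

theorem IsDini.continuousLinearMap_comp [NormedSpace ℝ E] [NormedSpace ℝ F]
    {g : BiharmonicAlgebra → E} (hg : IsDini g) (L : E →L[ℝ] F) : IsDini (fun τ => L (g τ)) :=
  hg.of_edist_le fun _ _ => L.lipschitz _ _

theorem isDini_id : IsDini (fun τ => τ) := by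
  have h : ∫⁻ _ in Ioc (0 : ℝ) 1, 1 < ⊤ := by simp
  refine lt_of_le_of_lt (setLIntegral_mono' measurableSet_Ioc fun η hη => ?_) h
  refine ENNReal.div_le_of_le_mul ?_
  rw [one_mul]
  refine modulusOfContinuity_le fun τ₁ _ τ₂ _ h => ?_
  rw [edist_dist, dist_eq_norm]
  exact ENNReal.ofReal_le_ofReal h

theorem isDini_const (c : F) : IsDini (fun _ => c) :=
  isDini_id.of_edist_le (K := 0) fun _ _ => by simp

end DiniOperations

/-! ### Cauchy and Schwartz kernels with values in the algebra -/

/-- Multiplication by a constant, as a continuous linear map. -/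
def mulConst (c : BiharmonicAlgebra) : BiharmonicAlgebra →L[ℝ] BiharmonicAlgebra :=
  (LinearMap.mulRight ℝ c).toContinuousLinearMap

@[simp] theorem mulConst_apply (c a : BiharmonicAlgebra) : mulConst c a = a * c := rfl

/-- `hol` as a continuous linear map. -/
def holL : BiharmonicAlgebra →L[ℝ] ℂ :=
  (ContinuousLinearMap.fst ℝ ℂ ℂ).comp dualEquiv.toContinuousLinearMap

/-- `nil` as a continuous linear map. -/
def nilL : BiharmonicAlgebra →L[ℝ] ℂ :=
  (ContinuousLinearMap.snd ℝ ℂ ℂ).comp dualEquiv.toContinuousLinearMap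

theorem continuous_mul_of_continuous {α : Type*} [TopologicalSpace α]
    {f g : α → BiharmonicAlgebra} (hf : Continuous f) (hg : Continuous g) :
    Continuous fun x => f x * g x := by
  have h1 := continuous_iff.1 hf
  have h2 := continuous_iff.1 hg
  refine continuous_iff.2 ⟨?_, ?_⟩
  · simp only [hol_mul]
    exact h1.1.mul h2.1
  · simp only [nil_mul]
    exact (h1.1.mul h2.2).add (h1.2.mul h2.1)

theorem hol_integral {f : ℝ → BiharmonicAlgebra} (hf : Continuous f) (a b : ℝ) :
    hol (∫ θ in a..b, f θ) = ∫ θ in a..b, hol (f θ) :=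
  (holL.intervalIntegral_comp_comm (hf.intervalIntegrable a b)).symm

theorem nil_integral {f : ℝ → BiharmonicAlgebra} (hf : Continuous f) (a b : ℝ) :
    nil (∫ θ in a..b, f θ) = ∫ θ in a..b, nil (f θ) :=
  (nilL.intervalIntegral_comp_comm (hf.intervalIntegrable a b)).symm

theorem integral_mul_const' {f : ℝ → BiharmonicAlgebra} (hf : Continuous f)
    (c : BiharmonicAlgebra) (a b : ℝ) :
    ∫ θ in a..b, f θ * c = (∫ θ in a..b, f θ) * c :=
  (mulConst c).intervalIntegral_comp_comm (hf.intervalIntegrable a b)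

theorem point_neg_sin_cos (θ : ℝ) :
    point (-Real.sin θ) (Real.cos θ) = pt (I * circleMap 0 1 θ) := by
  rw [pt, mul_re, mul_im, circleMap_zero_re, circleMap_zero_im]
  simp

/-- The Cauchy kernel `(τ - ζ)⁻¹ dτ / dθ`. -/
def cauchyKernel (z : ℂ) (θ : ℝ) : BiharmonicAlgebra :=
  Ring.inverse (pt (circleMap 0 1 θ - z)) * pt (I * circleMap 0 1 θ)

/-- The Schwartz kernel `(τ + ζ) (τ - ζ)⁻¹ τ⁻¹ dτ / dθ`. -/
def schwartzKernel (z : ℂ) (θ : ℝ) : BiharmonicAlgebra :=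
  (pt (circleMap 0 1 θ) + pt z) * Ring.inverse (pt (circleMap 0 1 θ - z)) *
    Ring.inverse (pt (circleMap 0 1 θ)) * pt (I * circleMap 0 1 θ)

theorem schwartzIntegral_pt (φ : BiharmonicAlgebra → BiharmonicAlgebra) (z : ℂ) :
    schwartzIntegral φ (pt z) = (1 / (2 * π * I) : ℂ) • ∫ θ in (0 : ℝ)..2 * π,
      φ (pt (circleMap 0 1 θ)) * schwartzKernel z θ := by
  simp only [schwartzIntegral, planeCircleIntegral, ← pt_circleMap, point_neg_sin_cos, ← pt_sub,
    schwartzKernel, mul_assoc]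

theorem isUnit_pt_circleMap_sub {z : ℂ} (hz : z ∈ ball (0 : ℂ) 1) (θ : ℝ) :
    IsUnit (pt (circleMap 0 1 θ - z)) :=
  isUnit_pt (circleMap_ne_of_mem_ball hz θ)

theorem circleMap_zero_one_ne_zero (θ : ℝ) : circleMap 0 1 θ ≠ 0 :=
  ne_zero_of_mem_sphere (circleMap_mem_unitSphere θ)

theorem im_circleMap (θ : ℝ) :
    ((circleMap 0 1 θ).im : ℂ) = (circleMap 0 1 θ - (circleMap 0 1 θ)⁻¹) / (2 * I) := by
  rw [im_eq_sub_conj, conj_eq_inv_of_mem_sphere (circleMap_mem_unitSphere θ)]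

theorem re_circleMap (θ : ℝ) :
    ((circleMap 0 1 θ).re : ℂ) = (circleMap 0 1 θ + (circleMap 0 1 θ)⁻¹) / 2 := by
  rw [re_eq_add_conj, conj_eq_inv_of_mem_sphere (circleMap_mem_unitSphere θ)]

theorem hol_cauchyKernel {z : ℂ} (hz : z ∈ ball (0 : ℂ) 1) (θ : ℝ) :
    hol (cauchyKernel z θ) = I * (circleMap 0 1 θ / (circleMap 0 1 θ - z)) := by
  rw [cauchyKernel, hol_mul, hol_inverse (isUnit_pt_circleMap_sub hz θ), hol_pt, hol_pt]
  ring

theorem nil_cauchyKernel {z : ℂ} (hz : z ∈ ball (0 : ℂ) 1) (θ : ℝ) :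
    nil (cauchyKernel z θ) = ((circleMap 0 1 θ).re * (circleMap 0 1 θ - z) -
      ((circleMap 0 1 θ).im - z.im) * (circleMap 0 1 θ * I)) / (circleMap 0 1 θ - z) ^ 2 := by
  have h := circleMap_ne_of_mem_ball hz θ
  have hu := isUnit_pt_circleMap_sub hz θ
  simp only [cauchyKernel, nil_mul, hol_inverse hu, nil_inverse hu, hol_pt, nil_pt, sub_im,
    ofReal_sub, I_mul_im]
  field_simp
  ring

theorem continuous_cauchyKernel {z : ℂ} (hz : z ∈ ball (0 : ℂ) 1) :
    Continuous (cauchyKernel z) := by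
  have := circleMap_ne_of_mem_ball hz
  refine continuous_iff.2 ⟨?_, ?_⟩
  · simp only [hol_cauchyKernel hz]
    fun_prop (disch := simpa using this)
  · simp only [nil_cauchyKernel hz]
    have h2 : ∀ θ, (circleMap 0 1 θ - z) ^ 2 ≠ 0 := fun θ => pow_ne_zero 2 (this θ)
    fun_prop (disch := simpa using h2)

/-- Partial fractions: `(τ + ζ) / ((τ - ζ) τ) = 2 / (τ - ζ) - 1 / τ`. -/
theorem schwartzKernel_eq {z : ℂ} (hz : z ∈ ball (0 : ℂ) 1) (θ : ℝ) :
    schwartzKernel z θ = (2 : ℝ) • cauchyKernel z θ - cauchyKernel 0 θ := by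
  have h1 := Ring.mul_inverse_cancel _ (isUnit_pt_circleMap_sub hz θ)
  have h2 := Ring.mul_inverse_cancel _ (isUnit_pt (circleMap_zero_one_ne_zero θ))
  have h3 : pt z = pt (circleMap 0 1 θ) - pt (circleMap 0 1 θ - z) := by
    rw [pt_sub, sub_sub_cancel]
  rw [schwartzKernel, cauchyKernel, cauchyKernel, sub_zero, two_smul, h3]
  linear_combination (2 * Ring.inverse (pt (circleMap 0 1 θ - z)) * h2 -
    Ring.inverse (pt (circleMap 0 1 θ)) * h1) * pt (I * circleMap 0 1 θ)

theorem pt_mul_schwartzKernel {z : ℂ} (hz : z ∈ ball (0 : ℂ) 1) (θ : ℝ) :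
    pt (circleMap 0 1 θ) * schwartzKernel z θ =
      pt (I * circleMap 0 1 θ) + cauchyKernel z θ * ((2 : ℝ) • pt z) := by
  have h1 := Ring.mul_inverse_cancel _ (isUnit_pt_circleMap_sub hz θ)
  have h2 := Ring.mul_inverse_cancel _ (isUnit_pt (circleMap_zero_one_ne_zero θ))
  rw [schwartzKernel, cauchyKernel, two_smul]
  rw [pt_sub] at h1 ⊢
  linear_combination (h1 + (pt (circleMap 0 1 θ) + pt z) *
    Ring.inverse (pt (circleMap 0 1 θ) - pt z) * h2) * pt (I * circleMap 0 1 θ)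

theorem continuous_schwartzKernel {z : ℂ} (hz : z ∈ ball (0 : ℂ) 1) :
    Continuous (schwartzKernel z) := by
  have h : schwartzKernel z = fun θ => (2 : ℝ) • cauchyKernel z θ - cauchyKernel 0 θ :=
    funext (schwartzKernel_eq hz)
  rw [h]
  exact ((continuous_cauchyKernel hz).const_smul (2 : ℝ)).sub
    (continuous_cauchyKernel (mem_ball_self one_pos))

theorem integral_cauchyKernel {z : ℂ} (hz : z ∈ ball (0 : ℂ) 1) :
    ∫ θ in (0 : ℝ)..2 * π, cauchyKernel z θ = (2 * π * I : ℂ) • 1 := by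
  have hc := continuous_cauchyKernel hz
  apply ext_hol_nil
  · rw [hol_integral hc]
    simp only [hol_cauchyKernel hz, intervalIntegral.integral_const_mul,
      intervalIntegral_circleMap_div_sub hz, hol_smul, hol_one]
    ring
  · rw [nil_integral hc, nil_smul, nil_one, mul_zero]
    -- The `ρ`-coordinate of the Cauchy kernel is an exact derivative of a periodic function, so it
    -- integrates to zero.
    have hd : ∀ θ : ℝ, HasDerivAt (fun θ : ℝ => (((circleMap 0 1 θ).im : ℂ) - z.im) /
        (circleMap 0 1 θ - z)) (nil (cauchyKernel z θ)) θ := fun θ => by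
      rw [nil_cauchyKernel hz]
      have h1 : HasDerivAt (fun θ : ℝ => circleMap 0 1 θ - z) (circleMap 0 1 θ * I) θ :=
        (hasDerivAt_circleMap 0 1 θ).sub_const z
      have h2 : HasDerivAt (fun θ : ℝ => ((circleMap 0 1 θ).im : ℂ) - z.im)
          ((circleMap 0 1 θ).re : ℂ) θ := by
        simp only [circleMap_zero_im, circleMap_zero_re, one_mul]
        exact (Real.hasDerivAt_sin θ).ofReal_comp.sub_const _
      exact h2.div h1 (circleMap_ne_of_mem_ball hz θ)
    rw [intervalIntegral.integral_eq_sub_of_hasDerivAt (fun θ _ => hd θ)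
      ((continuous_nil.comp hc).intervalIntegrable _ _)]
    have := periodic_circleMap 0 1 0
    rw [zero_add] at this
    rw [this, sub_self]

theorem integral_pt_mul_I : ∫ θ in (0 : ℝ)..2 * π, pt (I * circleMap 0 1 θ) = 0 := by
  have hd : ∀ θ : ℝ, HasDerivAt (fun θ : ℝ => pt (circleMap 0 1 θ)) (pt (I * circleMap 0 1 θ)) θ :=
    fun θ => by
      simp only [← point_neg_sin_cos, pt_circleMap, point]
      exact ((Real.hasDerivAt_cos θ).smul_const e₁).add ((Real.hasDerivAt_sin θ).smul_const e₂)
  have hc : Continuous fun θ : ℝ => pt (I * circleMap 0 1 θ) :=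
    continuous_pt.comp (by fun_prop)
  rw [intervalIntegral.integral_eq_sub_of_hasDerivAt (fun θ _ => hd θ) (hc.intervalIntegrable _ _)]
  have := periodic_circleMap 0 1 0
  rw [zero_add] at this
  rw [this, sub_self]

theorem two_pi_I_smul (a : BiharmonicAlgebra) :
    (1 / (2 * π * I) : ℂ) • (2 * π * I : ℂ) • a = a := by
  have hpi : (2 * π * I : ℂ) ≠ 0 := two_pi_I_ne_zero
  rw [smul_smul, one_div, inv_mul_cancel₀ hpi, one_smul]

theorem schwartzIntegral_one {z : ℂ} (hz : z ∈ ball (0 : ℂ) 1) :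
    schwartzIntegral (fun _ => 1) (pt z) = 1 := by
  have h0 := mem_ball_self (x := (0 : ℂ)) one_pos
  have hs : Continuous fun θ : ℝ => (2 : ℝ) • cauchyKernel z θ :=
    (continuous_cauchyKernel hz).const_smul (2 : ℝ)
  rw [schwartzIntegral_pt]
  simp only [one_mul, schwartzKernel_eq hz]
  rw [intervalIntegral.integral_sub
    (hs.intervalIntegrable _ _)
    ((continuous_cauchyKernel h0).intervalIntegrable _ _), intervalIntegral.integral_smul,
    integral_cauchyKernel hz, integral_cauchyKernel h0, two_smul, add_sub_cancel_right,
    two_pi_I_smul]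

/-- Together with `S[1] = 1` this puts every `ζ β + c` into the class, with density `τ β / 2 + c`.
-/
theorem schwartzIntegral_id {z : ℂ} (hz : z ∈ ball (0 : ℂ) 1) :
    schwartzIntegral (fun τ => τ) (pt z) = (2 : ℝ) • pt z := by
  have hc : Continuous fun θ : ℝ => pt (I * circleMap 0 1 θ) :=
    continuous_pt.comp (by fun_prop)
  have hc' := continuous_cauchyKernel hz
  rw [schwartzIntegral_pt]
  simp only [pt_mul_schwartzKernel hz]
  rw [intervalIntegral.integral_add (hc.intervalIntegrable _ _)
    ((continuous_mul_of_continuous hc' continuous_const).intervalIntegrable _ _),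
    integral_pt_mul_I, integral_mul_const' hc', integral_cauchyKernel hz, zero_add,
    Algebra.smul_mul_assoc, one_mul, two_pi_I_smul]

theorem schwartzIntegral_add {φ ψ : BiharmonicAlgebra → BiharmonicAlgebra}
    (hφ : Continuous fun θ : ℝ => φ (pt (circleMap 0 1 θ)))
    (hψ : Continuous fun θ : ℝ => ψ (pt (circleMap 0 1 θ))) {z : ℂ} (hz : z ∈ ball (0 : ℂ) 1) :
    schwartzIntegral (fun τ => φ τ + ψ τ) (pt z) =
      schwartzIntegral φ (pt z) + schwartzIntegral ψ (pt z) := by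
  have hk := continuous_schwartzKernel hz
  simp only [schwartzIntegral_pt, add_mul]
  rw [intervalIntegral.integral_add ((continuous_mul_of_continuous hφ hk).intervalIntegrable _ _)
    ((continuous_mul_of_continuous hψ hk).intervalIntegrable _ _), smul_add]

theorem schwartzIntegral_mul_const {φ : BiharmonicAlgebra → BiharmonicAlgebra}
    (hφ : Continuous fun θ : ℝ => φ (pt (circleMap 0 1 θ))) (c : BiharmonicAlgebra)
    {z : ℂ} (hz : z ∈ ball (0 : ℂ) 1) :
    schwartzIntegral (fun τ => φ τ * c) (pt z) = schwartzIntegral φ (pt z) * c := by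
  have hk := continuous_schwartzKernel hz
  simp only [schwartzIntegral_pt, mul_right_comm _ c]
  rw [integral_mul_const' (continuous_mul_of_continuous hφ hk), Algebra.smul_mul_assoc]

theorem hol_schwartzKernel {z : ℂ} (hz : z ∈ ball (0 : ℂ) 1) (θ : ℝ) :
    hol (schwartzKernel z θ) = I * ((circleMap 0 1 θ + z) / (circleMap 0 1 θ - z)) := by
  have h := circleMap_ne_of_mem_ball hz θ
  have h0 := circleMap_zero_one_ne_zero θ
  rw [schwartzKernel_eq hz, hol_sub, hol_real_smul, hol_cauchyKernel hz,
    hol_cauchyKernel (mem_ball_self one_pos)]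
  push_cast
  rw [sub_zero]
  field_simp
  ring

/-- On the circle `Im t` and `Re t` are rational in `t`, so all dependence on `z` is holomorphic
apart from the explicit factor `Im z`. -/
theorem nil_schwartzKernel {z : ℂ} (hz : z ∈ ball (0 : ℂ) 1) (θ : ℝ) :
    nil (schwartzKernel z θ) = z.im * (2 * I * (circleMap 0 1 θ / (circleMap 0 1 θ - z) ^ 2)) +
      (-z * (circleMap 0 1 θ / (circleMap 0 1 θ - z) ^ 2) + 2 * (1 / (circleMap 0 1 θ - z) ^ 2) -
        z * ((circleMap 0 1 θ)⁻¹ / (circleMap 0 1 θ - z) ^ 2) - (circleMap 0 1 θ ^ 2)⁻¹) := by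
  have h := circleMap_ne_of_mem_ball hz θ
  have h0 := circleMap_zero_one_ne_zero θ
  rw [schwartzKernel_eq hz, nil_sub, nil_real_smul, nil_cauchyKernel hz,
    nil_cauchyKernel (mem_ball_self one_pos), im_circleMap, re_circleMap, zero_im, ofReal_zero,
    sub_zero, sub_zero]
  push_cast
  field_simp
  ring

/-! ### Cauchy-type integrals and moments -/

/-- The integral of `g(θ) / (t - z) ^ n` over the unit circle, `t = exp (i θ)`. -/
def cauchyTypeIntegral (g : ℝ → ℂ) (n : ℕ) (z : ℂ) : ℂ :=
  ∫ θ in (0 : ℝ)..2 * π, g θ / (circleMap 0 1 θ - z) ^ n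

theorem continuous_div_circleMap_sub_pow {g : ℝ → ℂ} (hg : Continuous g) (n : ℕ) {z : ℂ}
    (hz : z ∈ ball (0 : ℂ) 1) : Continuous fun θ : ℝ => g θ / (circleMap 0 1 θ - z) ^ n :=
  hg.div (by fun_prop) fun θ => pow_ne_zero n (circleMap_ne_of_mem_ball hz θ)

theorem hasDerivAt_cauchyTypeIntegral {g : ℝ → ℂ} (hg : Continuous g) (n : ℕ) {z : ℂ}
    (hz : z ∈ ball (0 : ℂ) 1) :
    HasDerivAt (cauchyTypeIntegral g n) (n * cauchyTypeIntegral g (n + 1) z) z := by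
  have hz1 : ‖z‖ < 1 := by simpa using hz
  -- Half the distance to the circle: each `w` in `ball z ε` stays at distance at least `ε` from it,
  -- which bounds the differentiated integrand.
  set ε := (1 - ‖z‖) / 2 with hε
  have hε0 : 0 < ε := by rw [hε]; linarith
  have hsub : ∀ w ∈ ball z ε, ∀ θ : ℝ, ε ≤ ‖circleMap 0 1 θ - w‖ := fun w hw θ => by
    rw [mem_ball, dist_eq_norm] at hw
    have h1 := norm_sub_norm_le (circleMap 0 1 θ) w
    rw [norm_circleMap_zero, abs_one] at h1
    have h2 := norm_sub_norm_le w z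
    linarith
  have hball : ∀ w ∈ ball z ε, w ∈ ball (0 : ℂ) 1 := fun w hw => by
    rw [mem_ball, dist_eq_norm] at hw
    have h2 := norm_sub_norm_le w z
    rw [mem_ball_zero_iff]
    linarith
  have key := intervalIntegral.hasDerivAt_integral_of_dominated_loc_of_deriv_le
    (μ := volume) (a := 0) (b := 2 * π)
    (F := fun (w : ℂ) (θ : ℝ) => g θ / (circleMap 0 1 θ - w) ^ n)
    (F' := fun (w : ℂ) (θ : ℝ) => n * (g θ / (circleMap 0 1 θ - w) ^ (n + 1)))
    (x₀ := z) (s := ball z ε) (bound := fun θ => n * (‖g θ‖ / ε ^ (n + 1)))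
    (ball_mem_nhds z hε0)
    (by
      filter_upwards [ball_mem_nhds z hε0] with w hw
      exact (continuous_div_circleMap_sub_pow hg n (hball w hw)).aestronglyMeasurable)
    ((continuous_div_circleMap_sub_pow hg n hz).intervalIntegrable _ _)
    (continuous_const.mul (continuous_div_circleMap_sub_pow hg (n + 1) hz)).aestronglyMeasurable
    (ae_of_all _ fun θ _ w hw => by
      rw [norm_mul, norm_div, norm_pow, norm_natCast]
      gcongr
      exact hsub w hw θ)
    ((continuous_const.mul (hg.norm.div_const _)).intervalIntegrable _ _)
    (ae_of_all _ fun θ _ w hw => by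
      have h0 := circleMap_ne_of_mem_ball (hball w hw) θ
      have h1 : HasDerivAt (fun w : ℂ => circleMap 0 1 θ - w) (-1) w := by
        simpa using (hasDerivAt_id w).const_sub (circleMap 0 1 θ)
      have h2 := ((h1.pow n).inv (pow_ne_zero n h0)).const_mul (g θ)
      simp only [div_eq_mul_inv]
      refine h2.congr_deriv ?_
      rcases n with _ | n
      · simp
      · simp only [Nat.add_sub_cancel, Pi.pow_apply]
        field_simp
        ring)
  have := key.2
  rw [intervalIntegral.integral_const_mul] at this
  exact this

theorem differentiableOn_cauchyTypeIntegral {g : ℝ → ℂ} (hg : Continuous g) (n : ℕ) :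
    DifferentiableOn ℂ (cauchyTypeIntegral g n) (ball 0 1) := fun _ hz =>
  (hasDerivAt_cauchyTypeIntegral hg n hz).differentiableAt.differentiableWithinAt

theorem moment_eq (u : BiharmonicAlgebra → ℝ) (k : ℕ) :
    moment u (k + 1) = I * ∫ θ in (0 : ℝ)..2 * π,
      (u (pt (circleMap 0 1 θ)) : ℂ) * (circleMap 0 1 θ ^ k)⁻¹ := by
  rw [moment, circleIntegral, ← intervalIntegral.integral_const_mul]
  refine intervalIntegral.integral_congr fun θ _ => ?_
  have := circleMap_zero_one_ne_zero θ
  simp only [deriv_circleMap, smul_eq_mul]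
  rw [← pt]
  field_simp
  ring

/-- On the circle `1/t = t̄`, so the second moment of `u` is `∫ u sin θ dθ + i ∫ u cos θ dθ`. -/
theorem lineIntegral_eq {u₁ u₃ : BiharmonicAlgebra → ℝ} (hu₁ : IsDini u₁) (hu₃ : IsDini u₃) :
    lineIntegral u₁ u₃ = (moment u₃ 2).im - (moment u₁ 2).re := by
  have h : ∀ u : BiharmonicAlgebra → ℝ, IsDini u → ∀ L : ℂ →L[ℝ] ℝ,
      L (∫ θ in (0 : ℝ)..2 * π, (u (pt (circleMap 0 1 θ)) : ℂ) * (circleMap 0 1 θ ^ 1)⁻¹) =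
      ∫ θ in (0 : ℝ)..2 * π, L ((u (pt (circleMap 0 1 θ)) : ℂ) * (circleMap 0 1 θ ^ 1)⁻¹) := by
    intro u hu L
    refine (L.intervalIntegral_comp_comm (Continuous.intervalIntegrable ?_ _ _)).symm
    have := circleMap_zero_one_ne_zero
    exact (continuous_ofReal.comp hu.continuous_comp_circleMap).mul
      ((by fun_prop : Continuous fun θ : ℝ => circleMap 0 1 θ ^ 1).inv₀ fun θ => by simp)
  have hc : ∀ θ : ℝ, (circleMap 0 1 θ ^ 1)⁻¹ = conj (circleMap 0 1 θ) := fun θ => by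
    rw [pow_one, conj_eq_inv_of_mem_sphere (circleMap_mem_unitSphere θ)]
  have h1 := h u₁ hu₁ imCLM
  have h3 := h u₃ hu₃ reCLM
  rw [moment_eq, moment_eq, I_mul_im, I_mul_re]
  simp only [reCLM_apply, imCLM_apply] at h1 h3
  rw [h1, h3, sub_neg_eq_add, lineIntegral]
  simp only [hc, re_ofReal_mul, im_ofReal_mul, conj_re, conj_im, circleMap_zero_re,
    circleMap_zero_im, one_mul, pt_circleMap]
  have hcu : ∀ u : BiharmonicAlgebra → ℝ, IsDini u →
      Continuous fun θ : ℝ => u (point (Real.cos θ) (Real.sin θ)) := fun u hu => by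
    simpa only [pt_circleMap] using hu.continuous_comp_circleMap
  rw [intervalIntegral.integral_add, add_comm]
  · exact ((hcu u₁ hu₁).mul (by fun_prop)).intervalIntegrable _ _
  · exact ((hcu u₃ hu₃).mul (by fun_prop)).intervalIntegrable _ _

/-! ### Schwartz-type integrals of real densities -/

section RealDensity

variable {u : BiharmonicAlgebra → ℝ}

theorem IsDini.continuous_ofReal_circleMap (hu : IsDini u) :
    Continuous fun θ : ℝ => (u (pt (circleMap 0 1 θ)) : ℂ) :=
  continuous_ofReal.comp hu.continuous_comp_circleMap

theorem IsDini.continuous_ofReal_mul_circleMap (hu : IsDini u) :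
    Continuous fun θ : ℝ => (u (pt (circleMap 0 1 θ)) : ℂ) * circleMap 0 1 θ :=
  hu.continuous_ofReal_circleMap.mul (continuous_circleMap 0 1)

theorem continuous_inv_circleMap : Continuous fun θ : ℝ => (circleMap 0 1 θ)⁻¹ :=
  (continuous_circleMap 0 1).inv₀ circleMap_zero_one_ne_zero

theorem IsDini.continuous_ofReal_mul_inv_circleMap (hu : IsDini u) :
    Continuous fun θ : ℝ => (u (pt (circleMap 0 1 θ)) : ℂ) * (circleMap 0 1 θ)⁻¹ :=
  hu.continuous_ofReal_circleMap.mul continuous_inv_circleMap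

theorem IsDini.continuous_smul_schwartzKernel (hu : IsDini u) {z : ℂ} (hz : z ∈ ball (0 : ℂ) 1) :
    Continuous fun θ : ℝ => u (pt (circleMap 0 1 θ)) • schwartzKernel z θ :=
  hu.continuous_comp_circleMap.smul (continuous_schwartzKernel hz)

/-- The derivative of the Schwarz integral of `u`. -/
def schwarzDeriv (u : BiharmonicAlgebra → ℝ) (z : ℂ) : ℂ :=
  (2 * π : ℂ)⁻¹ * (2 * cauchyTypeIntegral
    (fun θ => u (pt (circleMap 0 1 θ)) * circleMap 0 1 θ) 2 z)

/-- The holomorphic part of the nilpotent coordinate of the Schwartz-type integral of `u`. -/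
def nilPart (u : BiharmonicAlgebra → ℝ) (z : ℂ) : ℂ :=
  (2 * π * I : ℂ)⁻¹ * (
    -z * cauchyTypeIntegral (fun θ => u (pt (circleMap 0 1 θ)) * circleMap 0 1 θ) 2 z +
    2 * cauchyTypeIntegral (fun θ => u (pt (circleMap 0 1 θ))) 2 z -
    z * cauchyTypeIntegral (fun θ => u (pt (circleMap 0 1 θ)) * (circleMap 0 1 θ)⁻¹) 2 z -
    ∫ θ in (0 : ℝ)..2 * π, (u (pt (circleMap 0 1 θ)) : ℂ) * (circleMap 0 1 θ ^ 2)⁻¹)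

theorem IsDini.differentiableOn_nilPart (hu : IsDini u) :
    DifferentiableOn ℂ (nilPart u) (ball 0 1) := by
  have hU := hu.continuous_ofReal_circleMap
  have h1 := differentiableOn_cauchyTypeIntegral (hu.continuous_ofReal_mul_circleMap) 2
  have h2 := differentiableOn_cauchyTypeIntegral hU 2
  have h3 := differentiableOn_cauchyTypeIntegral hu.continuous_ofReal_mul_inv_circleMap 2
  exact ((((differentiableOn_id.neg.mul h1).add (h2.const_mul 2)).sub
    (differentiableOn_id.mul h3)).sub_const _).const_mul _

theorem IsDini.hasDerivAt_schwarzIntegral (hu : IsDini u) {z : ℂ} (hz : z ∈ ball (0 : ℂ) 1) :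
    HasDerivAt (schwarzIntegral fun t => u (pt t)) (schwarzDeriv u z) z := by
  have hU := hu.continuous_ofReal_circleMap
  have hUt := hu.continuous_ofReal_mul_circleMap
  have h := (((hasDerivAt_cauchyTypeIntegral hUt 1 hz).const_mul 2).sub_const
    (∫ θ in (0 : ℝ)..2 * π, (u (pt (circleMap 0 1 θ)) : ℂ))).const_mul (2 * π : ℂ)⁻¹
  have heq : (schwarzIntegral fun t => u (pt t)) =ᶠ[𝓝 z] fun w => (2 * π : ℂ)⁻¹ *
      (2 * cauchyTypeIntegral (fun θ => u (pt (circleMap 0 1 θ)) * circleMap 0 1 θ) 1 w -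
      ∫ θ in (0 : ℝ)..2 * π, (u (pt (circleMap 0 1 θ)) : ℂ)) := by
    filter_upwards [isOpen_ball.mem_nhds hz] with w hw
    rw [schwarzIntegral, cauchyTypeIntegral, ← intervalIntegral.integral_const_mul 2,
      ← intervalIntegral.integral_sub _ (hU.intervalIntegrable _ _)]
    · congr 1
      refine intervalIntegral.integral_congr fun θ _ => ?_
      have := circleMap_ne_of_mem_ball hw θ
      field_simp
      ring
    · exact (continuous_const.mul (continuous_div_circleMap_sub_pow hUt 1 hw)).intervalIntegrable _ _
  refine (h.congr_of_eventuallyEq heq).congr_deriv ?_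
  simp [schwarzDeriv]

theorem schwartzIntegralReal_pt (u : BiharmonicAlgebra → ℝ) (z : ℂ) :
    schwartzIntegralReal u (pt z) = (1 / (2 * π * I) : ℂ) • ∫ θ in (0 : ℝ)..2 * π,
      u (pt (circleMap 0 1 θ)) • schwartzKernel z θ := by
  simp only [schwartzIntegralReal, schwartzIntegral_pt, e₁_eq_one, smul_mul_assoc, one_mul]

theorem IsDini.hol_schwartzIntegralReal (hu : IsDini u) {z : ℂ} (hz : z ∈ ball (0 : ℂ) 1) :
    hol (schwartzIntegralReal u (pt z)) = schwarzIntegral (fun t => u (pt t)) z := by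
  have hpi : (π : ℂ) ≠ 0 := by exact_mod_cast Real.pi_ne_zero
  rw [schwartzIntegralReal_pt, hol_smul,
    hol_integral (hu.continuous_smul_schwartzKernel hz),
    schwarzIntegral]
  simp only [hol_real_smul, hol_schwartzKernel hz, mul_left_comm _ I,
    intervalIntegral.integral_const_mul]
  field_simp

theorem IsDini.nil_schwartzIntegralReal (hu : IsDini u) {z : ℂ} (hz : z ∈ ball (0 : ℂ) 1) :
    nil (schwartzIntegralReal u (pt z)) = z.im * schwarzDeriv u z + nilPart u z := by
  have hpi : (π : ℂ) ≠ 0 := by exact_mod_cast Real.pi_ne_zero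
  have hU := hu.continuous_ofReal_circleMap
  have h1 := continuous_div_circleMap_sub_pow (hu.continuous_ofReal_mul_circleMap) 2 hz
  have h2 := continuous_div_circleMap_sub_pow hU 2 hz
  have h3 := continuous_div_circleMap_sub_pow hu.continuous_ofReal_mul_inv_circleMap 2 hz
  have h4 : Continuous fun θ : ℝ => (u (pt (circleMap 0 1 θ)) : ℂ) * (circleMap 0 1 θ ^ 2)⁻¹ := by
    simp only [← inv_pow]
    exact hU.mul (continuous_inv_circleMap.pow 2)
  rw [schwartzIntegralReal_pt, nil_smul,
    nil_integral (hu.continuous_smul_schwartzKernel hz)]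
  have hint : ∫ θ in (0 : ℝ)..2 * π, nil (u (pt (circleMap 0 1 θ)) • schwartzKernel z θ) =
      ∫ θ in (0 : ℝ)..2 * π, ((z.im * 2 * I - z) *
          (u (pt (circleMap 0 1 θ)) * circleMap 0 1 θ / (circleMap 0 1 θ - z) ^ 2) +
        2 * (u (pt (circleMap 0 1 θ)) / (circleMap 0 1 θ - z) ^ 2) -
        z * (u (pt (circleMap 0 1 θ)) * (circleMap 0 1 θ)⁻¹ / (circleMap 0 1 θ - z) ^ 2) -
        u (pt (circleMap 0 1 θ)) * (circleMap 0 1 θ ^ 2)⁻¹) := by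
    refine intervalIntegral.integral_congr fun θ _ => ?_
    simp only [nil_real_smul, nil_schwartzKernel hz]
    ring
  rw [hint, intervalIntegral.integral_sub, intervalIntegral.integral_sub,
    intervalIntegral.integral_add, intervalIntegral.integral_const_mul,
    intervalIntegral.integral_const_mul, intervalIntegral.integral_const_mul, schwarzDeriv, nilPart]
  · simp only [cauchyTypeIntegral]
    field_simp
    ring
  all_goals
    apply Continuous.intervalIntegrable
    fun_prop

/-- In this form the coefficient of the derivative is exactly what `one_sub_sq_norm_div` combines
with `Im z` into `(1 - |z|²)/(2iz)`; the moments are what survives on the circle. -/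
theorem IsDini.nilPart_eq (hu : IsDini u) {z : ℂ} (hz : z ∈ ball (0 : ℂ) 1) (h0 : z ≠ 0) :
    nilPart u z = -((z - 1 / z) / (2 * I)) * schwarzDeriv u z +
      (moment u 2 / z + moment u 3) / (2 * π) := by
  have hpi : (π : ℂ) ≠ 0 := by exact_mod_cast Real.pi_ne_zero
  have hU := hu.continuous_ofReal_circleMap
  have h1 := continuous_div_circleMap_sub_pow (hu.continuous_ofReal_mul_circleMap) 2 hz
  have h2 := continuous_div_circleMap_sub_pow hU 2 hz
  have h3 := continuous_div_circleMap_sub_pow hu.continuous_ofReal_mul_inv_circleMap 2 hz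
  have h4 : Continuous fun θ : ℝ => (u (pt (circleMap 0 1 θ)) : ℂ) * (circleMap 0 1 θ ^ 1)⁻¹ := by
    simp only [pow_one]
    exact hU.mul continuous_inv_circleMap
  -- The integrated form of `2tz = t² + z² - (t - z)²`, divided by `t z (t - z)²`.
  have key : 2 * cauchyTypeIntegral (fun θ => u (pt (circleMap 0 1 θ))) 2 z =
      (1 / z) * cauchyTypeIntegral (fun θ => u (pt (circleMap 0 1 θ)) * circleMap 0 1 θ) 2 z +
      z * cauchyTypeIntegral (fun θ => u (pt (circleMap 0 1 θ)) * (circleMap 0 1 θ)⁻¹) 2 z -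
      (1 / z) * ∫ θ in (0 : ℝ)..2 * π,
        (u (pt (circleMap 0 1 θ)) : ℂ) * (circleMap 0 1 θ ^ 1)⁻¹ := by
    simp only [cauchyTypeIntegral]
    simp only [← intervalIntegral.integral_const_mul]
    rw [← intervalIntegral.integral_add, ← intervalIntegral.integral_sub]
    · refine intervalIntegral.integral_congr fun θ _ => ?_
      have ht := circleMap_zero_one_ne_zero θ
      have hs := circleMap_ne_of_mem_ball hz θ
      field_simp
      ring
    all_goals
      apply Continuous.intervalIntegrable
      fun_prop
  rw [nilPart, key, moment_eq, moment_eq, schwarzDeriv]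
  field_simp
  ring_nf
  simp only [I_sq]
  ring

/-- The Schwartz-type integral of `u` extends continuously to the closed disk. -/
theorem IsDini.exists_continuous_extension (hu : IsDini u) :
    ∃ Ψ : ℂ → BiharmonicAlgebra, ContinuousOn Ψ (closedBall 0 1) ∧
      (∀ z ∈ ball (0 : ℂ) 1, Ψ z = schwartzIntegralReal u (pt z)) ∧
      ∀ z ∈ sphere (0 : ℂ) 1, (hol (Ψ z)).re = u (pt z) ∧
        nil (Ψ z) = (moment u 2 * conj z + moment u 3) / (2 * π) := by
  have hF : DifferentiableOn ℂ (schwarzIntegral fun t => u (pt t)) (ball 0 1) := fun z hz =>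
    (hu.hasDerivAt_schwarzIntegral hz).differentiableAt.differentiableWithinAt
  obtain ⟨A, hA, hA1, hA2⟩ := exists_diffContOnCl_extension hF hu.continuousOn_schwarzExtension
    fun z hz => (hu.schwarzExtension_eq hz.1 hz.2).symm
  have hdA : ∀ z ∈ ball (0 : ℂ) 1, deriv A z = schwarzDeriv u z := fun z hz => by
    rw [(hA1.eventuallyEq_of_mem (isOpen_ball.mem_nhds hz)).deriv_eq,
      (hu.hasDerivAt_schwarzIntegral hz).deriv]
  obtain ⟨W, hW, hW1, hW2⟩ := continuousOn_one_sub_sq_norm_mul_deriv hA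
  have hne : ∀ z ∈ closedBall (0 : ℂ) 1 \ {0}, 2 * I * z ≠ 0 := fun z hz =>
    mul_ne_zero (mul_ne_zero two_ne_zero I_ne_zero) hz.2
  -- Of the two formulas for the `ρ`-coordinate, `f` is regular at `0`, and `g` has a boundary limit
  -- because `W` vanishes on the circle.
  obtain ⟨B, hB, hB1, hB2⟩ := exists_continuousOn_extension
    (f := fun z => z.im * schwarzDeriv u z + nilPart u z)
    (g := fun z => W z / (2 * I * z) + (moment u 2 / z + moment u 3) / (2 * π))
    (by
      have h1 : DifferentiableOn ℂ (schwarzDeriv u) (ball 0 1) :=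
        (hA.differentiableOn.deriv isOpen_ball).congr fun z hz => (hdA z hz).symm
      have h2 : Continuous fun z : ℂ => (z.im : ℂ) := by fun_prop
      exact (h2.continuousOn.mul h1.continuousOn).add hu.differentiableOn_nilPart.continuousOn)
    (by
      refine ((hW.mono sdiff_subset).div (by fun_prop) hne).add
        (((continuousOn_const.div continuousOn_id fun z hz => hz.2).add
          continuousOn_const).div_const _))
    (by
      rintro z ⟨hz, h0⟩
      have h0 : z ≠ 0 := h0
      simp only [hu.nilPart_eq hz h0, hW1 z hz, hdA z hz]
      rw [mul_div_right_comm, one_sub_sq_norm_div h0]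
      ring)
  have hp : ∀ p : ℂ × ℂ, hol (dualEquiv.symm p) = p.1 ∧ nil (dualEquiv.symm p) = p.2 := fun p =>
    Prod.ext_iff.1 (dualEquiv.apply_symm_apply p)
  have hAc := hA.continuousOn
  rw [closure_ball _ one_ne_zero] at hAc
  refine ⟨fun z => dualEquiv.symm (A z, B z),
    dualEquiv.symm.continuous.comp_continuousOn (hAc.prodMk hB), fun z hz => ?_, fun z hz => ⟨?_, ?_⟩⟩
  · apply ext_hol_nil
    · rw [(hp _).1, hu.hol_schwartzIntegralReal hz]
      exact hA1 hz
    · rw [(hp _).2, hu.nil_schwartzIntegralReal hz]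
      exact hB1 hz
  · rw [(hp _).1]
    simp only [hA2 hz]
    exact re_schwarzExtension hz
  · rw [(hp _).2]
    refine (hB2 hz).trans ?_
    simp only [hW2 z hz, zero_div, zero_add, conj_eq_inv_of_mem_sphere hz, ← div_eq_mul_inv]

theorem IsDini.isMonogenicOn_schwartzIntegralReal (hu : IsDini u) :
    IsMonogenicOn (schwartzIntegralReal u) openDisk := by
  rw [isMonogenicOn_openDisk_iff]
  have h1 : EqOn (fun z => hol (schwartzIntegralReal u (pt z)))
      (schwarzIntegral fun t => u (pt t)) (ball 0 1) := fun z hz => hu.hol_schwartzIntegralReal hz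
  refine ⟨fun z hz => ?_, hu.differentiableOn_nilPart.congr fun z hz => ?_⟩
  · exact ((hu.hasDerivAt_schwarzIntegral hz).differentiableAt.differentiableWithinAt).congr h1 (h1 hz)
  · rw [(h1.eventuallyEq_of_mem (isOpen_ball.mem_nhds hz)).deriv_eq,
      (hu.hasDerivAt_schwarzIntegral hz).deriv, hu.nil_schwartzIntegralReal hz]
    ring

end RealDensity

/-! ### Operations on monogenic functions -/

section Monogenic

variable {Φ Ψ : BiharmonicAlgebra → BiharmonicAlgebra} {U : Set BiharmonicAlgebra}

theorem IsMonogenicOn.add (hΦ : IsMonogenicOn Φ U) (hΨ : IsMonogenicOn Ψ U) :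
    IsMonogenicOn (fun ζ => Φ ζ + Ψ ζ) U := fun ζ hζ => by
  obtain ⟨d, hd⟩ := hΦ ζ hζ
  obtain ⟨d', hd'⟩ := hΨ ζ hζ
  exact ⟨d + d', (Tendsto.add hd hd').congr fun h => by ring⟩

theorem IsMonogenicOn.sub (hΦ : IsMonogenicOn Φ U) (hΨ : IsMonogenicOn Ψ U) :
    IsMonogenicOn (fun ζ => Φ ζ - Ψ ζ) U := fun ζ hζ => by
  obtain ⟨d, hd⟩ := hΦ ζ hζ
  obtain ⟨d', hd'⟩ := hΨ ζ hζ
  exact ⟨d - d', (Tendsto.sub hd hd').congr fun h => by ring⟩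

theorem IsMonogenicOn.mul_const (hΦ : IsMonogenicOn Φ U) (c : BiharmonicAlgebra) :
    IsMonogenicOn (fun ζ => Φ ζ * c) U := fun ζ hζ => by
  obtain ⟨d, hd⟩ := hΦ ζ hζ
  refine ⟨d * c, (((mulConst c).continuous.tendsto d).comp hd).congr fun h => ?_⟩
  simp only [Function.comp_apply, mulConst_apply]
  ring

theorem isMonogenicOn_id : IsMonogenicOn (fun ζ => ζ) U := fun ζ _ => by
  refine ⟨1, tendsto_const_nhds.congr' ?_⟩
  filter_upwards [self_mem_nhdsWithin] with h hh
  rw [add_sub_cancel_left, Ring.mul_inverse_cancel h (isUnit_of_mem_plane hh.1 hh.2)]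

theorem isMonogenicOn_const (c : BiharmonicAlgebra) : IsMonogenicOn (fun _ => c) U := fun ζ _ =>
  ⟨0, tendsto_const_nhds.congr fun h => by simp⟩

theorem IsMonogenicOn.congr (hΦ : IsMonogenicOn Φ openDisk) (h : ∀ ζ ∈ openDisk, Ψ ζ = Φ ζ) :
    IsMonogenicOn Ψ openDisk := by
  rw [isMonogenicOn_openDisk_iff] at hΦ ⊢
  have h' : ∀ z ∈ ball (0 : ℂ) 1, Ψ (pt z) = Φ (pt z) := fun z hz => h _ (pt_mem_openDisk.2 hz)
  have e1 : EqOn (fun z => hol (Ψ (pt z))) (fun z => hol (Φ (pt z))) (ball 0 1) :=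
    fun z hz => by simp only [h' z hz]
  refine ⟨hΦ.1.congr e1, hΦ.2.congr fun z hz => ?_⟩
  rw [(e1.eventuallyEq_of_mem (isOpen_ball.mem_nhds hz)).deriv_eq, h' z hz]

end Monogenic

/-! ### The general solution -/

theorem generalSolution_eq (u₁ u₃ : BiharmonicAlgebra → ℝ) (a a₁ a₂ : ℝ) (ζ : BiharmonicAlgebra) :
    generalSolution u₁ u₃ a a₁ a₂ ζ = schwartzIntegralReal u₁ ζ * e₁ +
      schwartzIntegralReal u₃ ζ * e₂ + ζ * ((coeffB u₁ u₃ + I * a : ℂ) • 1) +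
      (coeffB₁ u₁ u₃ • e₁ + coeffB₂ u₁ u₃ • e₂ + I • (a₁ • e₁ + a₂ • e₂)) := by
  apply ext_hol_nil <;> simp [generalSolution] <;> ring

variable {u₁ u₃ : BiharmonicAlgebra → ℝ}

theorem exists_density (hu₁ : IsDini u₁) (hu₃ : IsDini u₃) (a a₁ a₂ : ℝ) :
    ∃ φ : BiharmonicAlgebra → BiharmonicAlgebra, IsDini φ ∧
      ∀ ζ ∈ openDisk, generalSolution u₁ u₃ a a₁ a₂ ζ = schwartzIntegral φ ζ := by
  have hD : ∀ u : BiharmonicAlgebra → ℝ, IsDini u → ∀ c : BiharmonicAlgebra,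
      IsDini (fun τ => (u τ • e₁) * c) := fun u hu c =>
    hu.continuousLinearMap_comp ((mulConst c).comp (ContinuousLinearMap.toSpanSingleton ℝ e₁))
  set β : BiharmonicAlgebra := (coeffB u₁ u₃ + I * a : ℂ) • 1 with hβ
  set c : BiharmonicAlgebra :=
    coeffB₁ u₁ u₃ • e₁ + coeffB₂ u₁ u₃ • e₂ + I • (a₁ • e₁ + a₂ • e₂) with hc
  -- The factor `2⁻¹` compensates for `S[τ] = 2ζ`.
  refine ⟨fun τ => (u₁ τ • e₁) * e₁ + (u₃ τ • e₁) * e₂ + τ * ((2⁻¹ : ℝ) • β) + 1 * c,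
    (((hD u₁ hu₁ e₁).add (hD u₃ hu₃ e₂)).add
      (isDini_id.continuousLinearMap_comp (mulConst _))).add (isDini_const _), fun ζ hζ => ?_⟩
  obtain ⟨z, rfl⟩ : ∃ z, pt z = ζ := ⟨_, pt_hol hζ.1⟩
  have hz := pt_mem_openDisk.1 hζ
  have hcu : ∀ u : BiharmonicAlgebra → ℝ, IsDini u →
      Continuous fun θ : ℝ => u (pt (circleMap 0 1 θ)) • e₁ := fun u hu =>
    hu.continuous_comp_circleMap.smul continuous_const
  have hcm : ∀ {f : ℝ → BiharmonicAlgebra}, Continuous f → ∀ d, Continuous fun θ => f θ * d :=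
    fun hf d => (mulConst d).continuous.comp hf
  have c1 := hcm (hcu u₁ hu₁) e₁
  have c3 := hcm (hcu u₃ hu₃) e₂
  have cid : Continuous fun θ : ℝ => pt (circleMap 0 1 θ) :=
    continuous_pt.comp (continuous_circleMap 0 1)
  have c4 := hcm cid ((2⁻¹ : ℝ) • β)
  rw [schwartzIntegral_add ((c1.add c3).add c4) continuous_const hz,
    schwartzIntegral_add (c1.add c3) c4 hz, schwartzIntegral_add c1 c3 hz,
    schwartzIntegral_mul_const (hcu u₁ hu₁) _ hz, schwartzIntegral_mul_const (hcu u₃ hu₃) _ hz,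
    schwartzIntegral_mul_const cid _ hz, schwartzIntegral_mul_const continuous_const _ hz,
    schwartzIntegral_id hz, schwartzIntegral_one hz, generalSolution_eq, one_mul,
    smul_mul_smul_comm, mul_inv_cancel₀ two_ne_zero, one_smul]
  rfl

theorem isMonogenicOn_generalSolution (hu₁ : IsDini u₁) (hu₃ : IsDini u₃) (a a₁ a₂ : ℝ) :
    IsMonogenicOn (generalSolution u₁ u₃ a a₁ a₂) openDisk := by
  rw [funext (generalSolution_eq u₁ u₃ a a₁ a₂)]
  exact (((hu₁.isMonogenicOn_schwartzIntegralReal.mul_const _).add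
    (hu₃.isMonogenicOn_schwartzIntegralReal.mul_const _)).add
    (isMonogenicOn_id.mul_const _)).add (isMonogenicOn_const _)

/-- The expression `generalSolution` extends continuously to the closed disk, and its boundary
values differ from the prescribed ones by a multiple of the line integral. -/
theorem exists_extension_generalSolution (hu₁ : IsDini u₁) (hu₃ : IsDini u₃) (a a₁ a₂ : ℝ) :
    ∃ Φ ∈ SchwartzClass, ContinuousOn Φ closedDisk ∧ IsMonogenicOn Φ openDisk ∧
      (∀ ζ ∈ openDisk, Φ ζ = generalSolution u₁ u₃ a a₁ a₂ ζ) ∧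
      ∀ z ∈ sphere (0 : ℂ) 1,
        (Φ (pt z)).re.re = u₁ (pt z) + lineIntegral u₁ u₃ / (2 * π) * z.im ∧
        (Φ (pt z)).im.re = u₃ (pt z) - lineIntegral u₁ u₃ / (2 * π) * z.re := by
  obtain ⟨Ψ₁, hc₁, hb₁, hs₁⟩ := hu₁.exists_continuous_extension
  obtain ⟨Ψ₃, hc₃, hb₃, hs₃⟩ := hu₃.exists_continuous_extension
  set β : BiharmonicAlgebra := (coeffB u₁ u₃ + I * a : ℂ) • 1 with hβ
  set c : BiharmonicAlgebra :=
    coeffB₁ u₁ u₃ • e₁ + coeffB₂ u₁ u₃ • e₂ + I • (a₁ • e₁ + a₂ • e₂) with hc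
  set Φ : BiharmonicAlgebra → BiharmonicAlgebra := fun ζ =>
    Ψ₁ (hol ζ) * e₁ + Ψ₃ (hol ζ) * e₂ + ζ * β + c with hΦ
  have hEq : ∀ ζ ∈ openDisk, Φ ζ = generalSolution u₁ u₃ a a₁ a₂ ζ := fun ζ hζ => by
    obtain ⟨z, rfl⟩ : ∃ z, pt z = ζ := ⟨_, pt_hol hζ.1⟩
    have hz := pt_mem_openDisk.1 hζ
    rw [generalSolution_eq, hΦ]
    simp only [hol_pt, hb₁ z hz, hb₃ z hz]
    rfl
  refine ⟨Φ, ?_, ?_, (isMonogenicOn_generalSolution hu₁ hu₃ a a₁ a₂).congr hEq, hEq, fun z hz => ?_⟩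
  · obtain ⟨φ, hφ, h⟩ := exists_density hu₁ hu₃ a a₁ a₂
    exact ⟨φ, hφ, fun ζ hζ => (hEq ζ hζ).trans (h ζ hζ)⟩
  · rw [continuousOn_closedDisk_iff]
    simp only [hΦ, hol_pt]
    exact ((((mulConst e₁).continuous.comp_continuousOn hc₁).add
      ((mulConst e₂).continuous.comp_continuousOn hc₃)).add
      ((mulConst β).continuous.comp continuous_pt).continuousOn).add continuousOn_const
  · obtain ⟨h1, h2⟩ := hs₁ z hz
    obtain ⟨h3, h4⟩ := hs₃ z hz
    have hdiv : ∀ w : ℂ, w / (2 * π) = ((1 / (2 * π) : ℝ) : ℂ) * w := fun w => by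
      push_cast
      ring
    rw [hdiv] at h2 h4
    have hL := lineIntegral_eq hu₁ hu₃
    have hpi := Real.pi_ne_zero
    rw [re_eq, im_eq]
    simp only [hΦ, hc, hβ, hol_pt, hol_add, hol_mul, hol_smul, hol_real_smul, nil_add, nil_mul,
      nil_smul, nil_real_smul, hol_e₁, hol_e₂, nil_e₁, nil_e₂, hol_one, nil_one, nil_pt, h2, h4, hL]
    -- The imaginary part of the Schwarz integral of `u₃` enters `Re A` and `Im B` with opposite
    -- signs and cancels in `U₁`. Of the moment terms, `b` cancels `x` in `U₁` and `y` in `U₃`, and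
    -- `b₁`, `b₂` cancel the constants.
    constructor
    · simp [h1, h3, coeffB, coeffB₁, coeffB₂]
      field_simp
      ring
    · simp [h3, coeffB, coeffB₁, coeffB₂]
      field_simp
      ring

/-- If the components `U₁`, `U₃` of a monogenic function have the boundary values `-l y` and `l x`,
then `l = 0`, and the function is `i (a ζ + a₁ e₁ + a₂ e₂)`. -/
theorem eq_of_boundary_values {Θ : BiharmonicAlgebra → BiharmonicAlgebra} {l : ℝ}
    (hc : ContinuousOn Θ closedDisk) (hm : IsMonogenicOn Θ openDisk)
    (hb : ∀ z ∈ sphere (0 : ℂ) 1,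
      (Θ (pt z)).re.re = -l * z.im ∧ (Θ (pt z)).im.re = l * z.re) :
    l = 0 ∧ ∃ a a₁ a₂ : ℝ, ∀ ζ ∈ openDisk, Θ ζ = I • (a • ζ + a₁ • e₁ + a₂ • e₂) := by
  rw [continuousOn_closedDisk_iff, continuousOn_iff] at hc
  rw [isMonogenicOn_openDisk_iff] at hm
  obtain ⟨hl, a, a₁, a₂, h⟩ := boundary_uniqueness (l := l)
    ⟨hm.1, by rw [closure_ball _ one_ne_zero]; exact hc.1⟩ hc.2 hm.2
    (fun z hz => by
      have := (hb z hz).1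
      rw [re_eq] at this
      simpa using this)
    (fun z hz => (hb z hz).2)
  refine ⟨hl, a, a₁, a₂, fun ζ hζ => ?_⟩
  obtain ⟨z, rfl⟩ : ∃ z, pt z = ζ := ⟨_, pt_hol hζ.1⟩
  obtain ⟨h1, h2⟩ := h z (pt_mem_openDisk.1 hζ)
  apply ext_hol_nil
  · simpa [mul_add] using h1
  · simpa [mul_add] using h2

/-- The extension with `a = a₁ = a₂ = 0` exists whether or not the line integral vanishes; its
boundary defect is exactly what `eq_of_boundary_values` handles, so solvability and the form of the
solution come out together. -/
theorem SolvesProblem13.lineIntegral_eq_zero_and (hu₁ : IsDini u₁) (hu₃ : IsDini u₃)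
    {Φ : BiharmonicAlgebra → BiharmonicAlgebra} (hΦ : SolvesProblem13 u₁ u₃ Φ) :
    lineIntegral u₁ u₃ = 0 ∧
      ∃ a a₁ a₂ : ℝ, ∀ ζ ∈ openDisk, Φ ζ = generalSolution u₁ u₃ a a₁ a₂ ζ := by
  obtain ⟨Ψ, -, hc, hm, hEq, hb⟩ := exists_extension_generalSolution hu₁ hu₃ 0 0 0
  obtain ⟨hl, a, a₁, a₂, h⟩ := eq_of_boundary_values (l := lineIntegral u₁ u₃ / (2 * π))
    (hΦ.continuousOn.sub hc) (hΦ.monogenic.sub hm) fun z hz => by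
      have hz' := pt_mem_unitCircle.2 hz
      have h1 := hΦ.boundary₁ _ hz'
      have h3 := hΦ.boundary₃ _ hz'
      obtain ⟨h1', h3'⟩ := hb z hz
      change (Φ (pt z) - Ψ (pt z)).re.re = _ ∧ (Φ (pt z) - Ψ (pt z)).im.re = _
      simp only [QuadraticAlgebra.re_sub, QuadraticAlgebra.im_sub, sub_re, h1, h3, h1', h3']
      constructor <;> ring
  refine ⟨by simpa [Real.pi_ne_zero] using hl, a, a₁, a₂, fun ζ hζ => ?_⟩
  have h' : Φ ζ - Ψ ζ = _ := h ζ hζ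
  rw [hEq ζ hζ, sub_eq_iff_eq_add] at h'
  rw [h']
  simp only [generalSolution, zero_smul, add_zero, smul_zero]
  exact add_comm _ _

end BiharmonicAlgebra

end

theorem theorem2 (u₁ u₃ : BiharmonicAlgebra → ℝ)
    (hu₁ : BiharmonicAlgebra.IsDini u₁) (hu₃ : BiharmonicAlgebra.IsDini u₃) :
    ((∃ Φ ∈ BiharmonicAlgebra.SchwartzClass, BiharmonicAlgebra.SolvesProblem13 u₁ u₃ Φ) ↔
        BiharmonicAlgebra.lineIntegral u₁ u₃ = 0) ∧
    (BiharmonicAlgebra.lineIntegral u₁ u₃ = 0 →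
      (∀ Φ ∈ BiharmonicAlgebra.SchwartzClass, BiharmonicAlgebra.SolvesProblem13 u₁ u₃ Φ →
        ∃ a a₁ a₂ : ℝ, ∀ ζ ∈ BiharmonicAlgebra.openDisk,
          Φ ζ = BiharmonicAlgebra.generalSolution u₁ u₃ a a₁ a₂ ζ) ∧
      (∀ a a₁ a₂ : ℝ,
        ∃ Φ ∈ BiharmonicAlgebra.SchwartzClass, BiharmonicAlgebra.SolvesProblem13 u₁ u₃ Φ ∧
          ∀ ζ ∈ BiharmonicAlgebra.openDisk,
            Φ ζ = BiharmonicAlgebra.generalSolution u₁ u₃ a a₁ a₂ ζ)) := by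
  have hex : BiharmonicAlgebra.lineIntegral u₁ u₃ = 0 → ∀ a a₁ a₂ : ℝ,
      ∃ Φ ∈ BiharmonicAlgebra.SchwartzClass, BiharmonicAlgebra.SolvesProblem13 u₁ u₃ Φ ∧
        ∀ ζ ∈ BiharmonicAlgebra.openDisk,
          Φ ζ = BiharmonicAlgebra.generalSolution u₁ u₃ a a₁ a₂ ζ := by
    intro h0 a a₁ a₂
    obtain ⟨Φ, hS, hc, hm, hEq, hb⟩ :=
      BiharmonicAlgebra.exists_extension_generalSolution hu₁ hu₃ a a₁ a₂
    simp only [h0, zero_div, zero_mul, add_zero, sub_zero] at hb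
    have hb' : ∀ ζ ∈ BiharmonicAlgebra.unitCircle,
        (Φ ζ).re.re = u₁ ζ ∧ (Φ ζ).im.re = u₃ ζ := fun ζ hζ => by
      have h := BiharmonicAlgebra.pt_hol hζ.1
      have := hb _ (BiharmonicAlgebra.pt_mem_unitCircle.1 (h.symm ▸ hζ))
      rwa [h] at this
    exact ⟨Φ, hS, ⟨hc, hm, fun ζ hζ => (hb' ζ hζ).1, fun ζ hζ => (hb' ζ hζ).2⟩, hEq⟩
  refine ⟨⟨?_, fun h0 => ?_⟩, fun h0 => ⟨fun Φ _ hΦ => ?_, hex h0⟩⟩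
  · rintro ⟨Φ, -, hΦ⟩
    exact (hΦ.lineIntegral_eq_zero_and hu₁ hu₃).1
  · obtain ⟨Φ, hS, hΦ, -⟩ := hex h0 0 0 0
    exact ⟨Φ, hS, hΦ⟩
  · exact (hΦ.lineIntegral_eq_zero_and hu₁ hu₃).2
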